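/- **Theorem (robust estimation with the jointly robust prior).** Let $p\ge 1$, let $\mathbf x_1,\dots,\mathbf x_n\in\mathbb R^{p}$ be distinct design points such that no coordinate is constant over the design, let $h_1,\dots,h_q$ be mean basis functions, $q<n$, and assume that the $n\times q$ matrix $\mathbf H=(h_t(\mathbf x_i))$ has rank $q$. Let $\mathbf R(\boldsymbol\gamma)$ be the product correlation matrix with range parameters $\boldsymbol\gamma\in(0,\infty)^p$, with entries $\prod_{l=1}^{p}c_l(|x_{il}-x_{jl}|)$, where each $c_l$ is either a power exponential correlation $c_l(d)=\exp\{-(d/\gamma_l)^{\alpha_l}\}$ with $\alpha_l\in(0,2]$, or a Matérn correlation $c_l(d)=\frac{1}{2^{\alpha_l-1}\Gamma(\alpha_l)}(d/\gamma_l)^{\alpha_l}\mathcal K_{\alpha_l}(d/\gamma_l)$, $c_l(0)=1$, with $\alpha_l>0$ ($\mathcal K$ is the modified Bessel function of the second kind). For data $\mathbf y\in\mathbb R^n$ let $$L(\boldsymbol\gamma\mid\mathbf y)=\int_0^\infty\int_{\mathbb R^q}\mathrm{N}\big(\mathbf y;\,\mathbf H\boldsymbol\theta,\,\sigma^2\mathbf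 R(\boldsymbol\gamma)\big)\,\frac{1}{\sigma^2}\,d\boldsymbol\theta\,d\sigma^2$$ be the marginal likelihood, where $\mathrm N(\mathbf y;\boldsymbol\mu,\boldsymbol\Sigma)$ is the multivariate normal density. For $\beta_l=1/\gamma_l$ let $$\pi^{JR}(\boldsymbol\beta)=C_0\Big(\sum_{l=1}^{p}C_l\beta_l\Big)^{a}\exp\Big\{-b\sum_{l=1}^{p}C_l\beta_l\Big\},\qquad C_0=\frac{(p-1)!\,b^{a+p}\prod_{l=1}^{p}C_l}{\Gamma(a+p)},$$ be the jointly robust prior. The marginal posterior density, up to a constant, is $L$ times the prior density. Under the parameterization by $\boldsymbol\beta\in(0,\infty)^p$ the prior density is $\pi^{JR}(\boldsymbol\beta)$; under the parameterizations by $\boldsymbol\gamma\in(0,\infty)^p$ and by $\boldsymbol\xi\in\mathbb R^p$, $\xi_l=\log(1/\gamma_l)$, it is $\pi^{JR}(1/\gamma_1,\dots,1/\gamma_p)\prod_l\gamma_l^{-2}$ and $\pi^{JR}(e^{\xi_1},\dots,e^{\xi_p})\prod_le^{\xi_l}$, respectively. Marginal posterior mode estimation under a given parameterization is called *robust* if neither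 $\mathbf 1_n\mathbf 1_n^T$ nor $\mathbf I_n$ is an estimated correlation matrix, where the estimated correlation matrices $\hat{\mathbf R}$ are the limits of the correlation matrix along those sequences of parameters along which the marginal posterior density tends to its supremum (this covers maximizers as well as maxima that are approached only when some parameters tend to the boundary or to infinity). Then for Lebesgue-almost every $\mathbf y\in\mathbb R^n$ (with an exceptional set that does not depend on $a,b,C_1,\dots,C_p$) the following holds for all $b>0$ and all $C_1,\dots,C_p>0$: * if $a>-p$, then the marginal posterior mode estimation with the jointly robust prior is robust under the parameterization by $\boldsymbol\gamma$, and also under the parameterization by $\boldsymbol\xi$; * if $a>0$, then the marginal posterior mode estimation with the jointly robust prior is robust under the parameterization by $\boldsymbol\beta$. -/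

import Mathlib

open MeasureTheory Filter Topology Matrix
open scoped ENNReal

noncomputable section

/-- Modified Bessel function of the second kind,
`K_ν(z) = ∫_0^∞ exp (-z cosh t) cosh (ν t) dt` for `z > 0`. -/
def besselK (ν z : ℝ) : ℝ :=
  ∫ t in Set.Ioi (0 : ℝ), Real.exp (-z * Real.cosh t) * Real.cosh (ν * t)

/-- The two classes of one-dimensional correlation functions, with their roughness parameter. -/
inductive CorrFamily where
  | powerExponential (α : ℝ)
  | matern (α : ℝ)

/-- Admissible roughness parameters: `α ∈ (0, 2]` for the power exponential correlation,
`α > 0` for the Matérn correlation. -/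
def CorrFamily.Admissible : CorrFamily → Prop
  | .powerExponential α => 0 < α ∧ α ≤ 2
  | .matern α => 0 < α

/-- The one-dimensional correlation at distance `d ≥ 0` with range parameter `γ > 0`
(the Matérn correlation at distance `0` is `1`, the limit of the formula). -/
def CorrFamily.corr : CorrFamily → ℝ → ℝ → ℝ
  | .powerExponential α, γ, d => Real.exp (-(d / γ) ^ α)
  | .matern α, γ, d =>
      if d = 0 then 1
      else 1 / ((2 : ℝ) ^ (α - 1) * Real.Gamma α) * (d / γ) ^ α * besselK α (d / γ)

/-- The correlation matrix at the design points `x 0, …, x (n - 1)` in `ℝ^p`: the Hadamard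
product of the correlation matrices of the coordinates. -/
def corrMatrix {n p : ℕ} (c : Fin p → CorrFamily) (x : Fin n → Fin p → ℝ) (γ : Fin p → ℝ) :
    Matrix (Fin n) (Fin n) ℝ :=
  Matrix.of fun i j => ∏ l, (c l).corr (γ l) |x i l - x j l|

/-- The mean basis matrix, with entries `h_t (x_i)`. -/
def basisMatrix {n p q : ℕ} (h : Fin q → (Fin p → ℝ) → ℝ) (x : Fin n → Fin p → ℝ) :
    Matrix (Fin n) (Fin q) ℝ :=
  Matrix.of fun i t => h t (x i)

/-- Density at `y` of the multivariate normal distribution with mean `μ` and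
covariance matrix `v • R` (where `v` is the variance `σ²`). -/
def normalDensity {n : ℕ} (μ : Fin n → ℝ) (v : ℝ) (R : Matrix (Fin n) (Fin n) ℝ)
    (y : Fin n → ℝ) : ℝ :=
  (Real.sqrt ((2 * Real.pi * v) ^ n * R.det))⁻¹ *
    Real.exp (-((y - μ) ⬝ᵥ (R⁻¹ *ᵥ (y - μ))) / (2 * v))

/-- The marginal likelihood of the correlation matrix `R`: the mean parameter `θ` and the
variance `v = σ²` are integrated out of the normal likelihood with respect to the
prior `dθ dv / v`. -/
def marginalLikelihood {n q : ℕ} (H : Matrix (Fin n) (Fin q) ℝ)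
    (R : Matrix (Fin n) (Fin n) ℝ) (y : Fin n → ℝ) : ℝ≥0∞ :=
  ∫⁻ v in Set.Ioi (0 : ℝ), ∫⁻ θ : Fin q → ℝ,
    ENNReal.ofReal (normalDensity (H *ᵥ θ) v R y * (1 / v))

/-- The jointly robust prior density of the inverse range parameters `β`, with its
normalizing constant. -/
def jrPrior {p : ℕ} (a b : ℝ) (C : Fin p → ℝ) (β : Fin p → ℝ) : ℝ :=
  (((p - 1).factorial : ℝ) * b ^ (a + p) * ∏ l, C l) / Real.Gamma (a + p) *
    (∑ l, C l * β l) ^ a * Real.exp (-b * ∑ l, C l * β l)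

/-- The prior density of the range parameters `γ_l = 1 / β_l`
(Jacobian `∏ γ_l ^ (-2)`). -/
def jrPriorRange {p : ℕ} (a b : ℝ) (C : Fin p → ℝ) (γ : Fin p → ℝ) : ℝ :=
  jrPrior a b C (fun l => 1 / γ l) * ∏ l, 1 / γ l ^ 2

/-- The prior density of the log inverse range parameters `ξ_l = log (1 / γ_l) = log β_l`
(Jacobian `∏ exp ξ_l`). -/
def jrPriorLogInvRange {p : ℕ} (a b : ℝ) (C : Fin p → ℝ) (ξ : Fin p → ℝ) : ℝ :=
  jrPrior a b C (fun l => Real.exp (ξ l)) * ∏ l, Real.exp (ξ l)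

/-- The matrices that arise as estimated correlation matrix when the objective `f` is maximized
over the parameter set `S`: the limits of the correlation matrix `R` along the sequences of
parameters in `S` along which `f` tends to its supremum. A maximizer in `S` is covered by the
constant sequence, and a maximum approached only at the boundary of `S` or at infinity by a
sequence that tends to it. -/
def estimatedCorr {n : ℕ} {Θ : Type*} (S : Set Θ) (f : Θ → ℝ≥0∞)
    (R : Θ → Matrix (Fin n) (Fin n) ℝ) : Set (Matrix (Fin n) (Fin n) ℝ) :=
  {M | ∃ u : ℕ → Θ, (∀ k, u k ∈ S) ∧
    Tendsto (fun k => f (u k)) atTop (𝓝 (⨆ θ ∈ S, f θ)) ∧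
    Tendsto (fun k => R (u k)) atTop (𝓝 M)}

/-- Robust estimation: the estimated correlation matrix is neither the matrix of ones nor
the identity matrix. -/
def IsRobustEstimation {n : ℕ} {Θ : Type*} (S : Set Θ) (f : Θ → ℝ≥0∞)
    (R : Θ → Matrix (Fin n) (Fin n) ℝ) : Prop :=
  ∀ M ∈ estimatedCorr S f R, M ≠ Matrix.of (fun _ _ => (1 : ℝ)) ∧ M ≠ 1

/-- Robustness of the marginal posterior mode of the range parameters `γ ∈ (0, ∞)^p`. -/
def RobustRange {n p q : ℕ} (c : Fin p → CorrFamily) (x : Fin n → Fin p → ℝ)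
    (h : Fin q → (Fin p → ℝ) → ℝ) (a b : ℝ) (C : Fin p → ℝ) (y : Fin n → ℝ) : Prop :=
  IsRobustEstimation {γ : Fin p → ℝ | ∀ l, 0 < γ l}
    (fun γ => marginalLikelihood (basisMatrix h x) (corrMatrix c x γ) y *
      ENNReal.ofReal (jrPriorRange a b C γ))
    (fun γ => corrMatrix c x γ)

/-- Robustness of the marginal posterior mode of the log inverse range parameters
`ξ ∈ ℝ^p`, where `γ_l = exp (-ξ_l)`. -/
def RobustLogInvRange {n p q : ℕ} (c : Fin p → CorrFamily) (x : Fin n → Fin p → ℝ)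
    (h : Fin q → (Fin p → ℝ) → ℝ) (a b : ℝ) (C : Fin p → ℝ) (y : Fin n → ℝ) : Prop :=
  IsRobustEstimation (Set.univ : Set (Fin p → ℝ))
    (fun ξ => marginalLikelihood (basisMatrix h x)
        (corrMatrix c x (fun l => Real.exp (-ξ l))) y *
      ENNReal.ofReal (jrPriorLogInvRange a b C ξ))
    (fun ξ => corrMatrix c x (fun l => Real.exp (-ξ l)))

/-- Robustness of the marginal posterior mode of the inverse range parameters
`β ∈ (0, ∞)^p`, where `γ_l = 1 / β_l`. -/
def RobustInvRange {n p q : ℕ} (c : Fin p → CorrFamily) (x : Fin n → Fin p → ℝ)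
    (h : Fin q → (Fin p → ℝ) → ℝ) (a b : ℝ) (C : Fin p → ℝ) (y : Fin n → ℝ) : Prop :=
  IsRobustEstimation {β : Fin p → ℝ | ∀ l, 0 < β l}
    (fun β => marginalLikelihood (basisMatrix h x)
        (corrMatrix c x (fun l => 1 / β l)) y *
      ENNReal.ofReal (jrPrior a b C β))
    (fun β => corrMatrix c x (fun l => 1 / β l))

end

/-! The posterior is the likelihood times the prior. For almost every `y` the likelihood is bounded
over all range parameters, while in each parameterization the prior is at most a constant times `S ^
s * exp (-b * S)`, where `S = ∑ l, C l * β l` and `s > 0`. If the correlation matrix tends to the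
matrix of ones, every `β l` tends to zero because no coordinate is constant over the design, so `S →
0`; if it tends to the identity, the largest `β l` diverges, so `S → ∞`. Either way the posterior
tends to zero, whereas its supremum is positive because distinct design points make some correlation
matrix nonsingular (`isRobustEstimation_of_bounds`).

The substance is the bound of the likelihood near singular matrices. It rests on a uniform
description (`exists_isFramed_corrMatrix`): finitely many vectors `w k`, fixed by the design, frame
every correlation matrix, in that its quadratic form lies within a fixed factor of `∑ k, t k * (w k
⬝ᵥ a) ^ 2` for some weights `t k ≥ 0`. For one-dimensional Gaussian kernels this follows from the
exponential series. It passes to conic combinations and limits, and through the Schur product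
theorem to products over coordinates. Power exponential and Matérn kernels lie in the closed algebra
generated by Gaussian kernels.

A greedy choice of heavy vectors turns the framed form into a positive diagonal form in one of
finitely many coordinate systems `W` (`exists_diagonal_comparison`). In these coordinates the
likelihood is dominated by one with independent observations of variances proportional to `t i`. The
mean parameter is integrated out against greedily chosen independent rows of smallest weight. Let
`j` be the lightest remaining row; its residual `r` after elimination does not depend on the mean
parameter. Integration over the variance gives a multiple of `(r ^ 2 / t j) ^ (-(n - q) / 2)`, and
the power of `t j` cancels against the determinant (`exists_marginalLikelihood_le`). Only `r ≠ 0` is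
needed, for finitely many nonzero linear forms in `y`; hence an exceptional null set that does not
involve the prior. -/

/-- The quadratic form of a kernel. -/
def quadForm {ι : Type*} [Fintype ι] (M : ι → ι → ℝ) (a : ι → ℝ) : ℝ :=
  ∑ i, ∑ j, a i * a j * M i j

/-! ### Reduction of powers at rescaled nodes -/

section PowerReduction

/-- Multiplication by `u` shifts the coefficients, and the overflowing power `u ^ (m + 1)` is
replaced by the given relation; each such step enlarges the coefficients by a factor of at most `1 +
P`. -/
theorem exists_pow_reduction {ι : Type*} {m : ℕ} (u : ι → ℝ) (c : Fin (m + 1) → ℝ) {P : ℝ}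
    (hc : ∀ i, |c i| ≤ P) (hu : ∀ j, u j ^ (m + 1) = ∑ i : Fin (m + 1), c i * u j ^ (i : ℕ))
    (k : ℕ) :
    ∃ b : Fin (m + 1) → ℝ, (∀ i, |b i| ≤ (1 + P) ^ k) ∧
      ∀ j, u j ^ k = ∑ i : Fin (m + 1), b i * u j ^ (i : ℕ) := by
  have hP : 0 ≤ P := (abs_nonneg _).trans (hc 0)
  induction k with
  | zero =>
    refine ⟨fun i => if i = 0 then 1 else 0, fun i => ?_, fun j => ?_⟩
    · by_cases h : i = 0 <;> simp [h]
    · simp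
  | succ k ih =>
    obtain ⟨b, hb, hbu⟩ := ih
    refine ⟨fun i => Fin.cases 0 (fun i => b i.castSucc) i + b (Fin.last m) * c i,
      fun i => ?_, fun j => ?_⟩
    · have h1 : |(Fin.cases 0 (fun i => b i.castSucc) i : ℝ)| ≤ (1 + P) ^ k := by
        refine Fin.cases ?_ (fun i => ?_) i
        · simp; positivity
        · simpa using hb i.castSucc
      calc _ ≤ _ := abs_add_le _ _
        _ ≤ (1 + P) ^ k + (1 + P) ^ k * P := by
          rw [abs_mul]
          gcongr
          · exact hb _
          · exact hc _
        _ = _ := by ring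
    · rw [pow_succ, hbu j, Fin.sum_univ_castSucc, add_mul, Finset.sum_mul]
      have : b (Fin.last m) * u j ^ ((Fin.last m : Fin (m + 1)) : ℕ) * u j
          = b (Fin.last m) * u j ^ (m + 1) := by simp; ring
      rw [this, hu j]
      simp only [add_mul, Finset.sum_add_distrib]
      congr 1
      · rw [Fin.sum_univ_succ]
        simp [pow_succ, mul_assoc]
      · rw [Finset.mul_sum]; simp [mul_assoc]

/-- Uniform reduction of the powers of rescaled nodes to the first powers. -/
theorem exists_uniform_pow_reduction {m : ℕ} (x : Fin (m + 1) → ℝ) :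
    ∃ M : ℝ, 1 ≤ M ∧ ∀ τ : ℝ, 0 ≤ τ → τ ≤ 1 → ∀ k : ℕ,
      ∃ b : Fin (m + 1) → ℝ, (∀ i, |b i| ≤ M ^ k) ∧
        ∀ j, (τ * x j) ^ k = ∑ i : Fin (m + 1), b i * (τ * x j) ^ (i : ℕ) := by
  let p : Polynomial ℝ := ∏ j, (Polynomial.X - Polynomial.C (x j))
  have hpm : p.Monic := Polynomial.monic_prod_of_monic _ _ fun j _ => Polynomial.monic_X_sub_C _
  have hpd : p.natDegree = m + 1 := by
    simp [p, Polynomial.natDegree_prod_of_monic _ _ fun j _ => Polynomial.monic_X_sub_C (x j)]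
  have hroot : ∀ j, p.eval (x j) = 0 := fun j => by
    simp only [p, Polynomial.eval_prod]
    exact Finset.prod_eq_zero (Finset.mem_univ j) (by simp)
  have hrel : ∀ j, x j ^ (m + 1) = ∑ i : Fin (m + 1), -p.coeff i * x j ^ (i : ℕ) := fun j => by
    have h := hroot j
    rw [Polynomial.eval_eq_sum_range, hpd, Finset.sum_range_succ] at h
    have h1 : p.coeff (m + 1) = 1 := by rw [← hpd]; exact hpm
    rw [h1, Finset.sum_range] at h
    simp only [neg_mul, Finset.sum_neg_distrib]
    linarith
  refine ⟨1 + ∑ i : Fin (m + 1), |p.coeff i|, ?_, fun τ h0 h1 k => ?_⟩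
  · linarith [Finset.sum_nonneg fun (i : Fin (m + 1)) (_ : i ∈ Finset.univ) =>
      abs_nonneg (p.coeff i)]
  -- The relation is the polynomial with roots `x j`, homogenized in `τ`. Its coefficients carry the
  -- factor `τ ^ (m + 1 - i) ≤ 1`, which is why the bound is uniform in `τ`.
  · refine exists_pow_reduction (fun j => τ * x j)
      (fun i => -p.coeff i * τ ^ (m + 1 - (i : ℕ))) (fun i => ?_) (fun j => ?_) k
    · rw [abs_mul, abs_neg, abs_of_nonneg (pow_nonneg h0 _)]
      calc _ ≤ |p.coeff i| * 1 := by gcongr; exact pow_le_one₀ h0 h1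
        _ ≤ _ := by
          rw [mul_one]
          exact Finset.single_le_sum (f := fun i : Fin (m + 1) => |p.coeff i|)
            (fun i _ => abs_nonneg _) (Finset.mem_univ i)
    · rw [mul_pow, hrel, Finset.mul_sum]
      refine Finset.sum_congr rfl fun i _ => ?_
      have : τ ^ (m + 1) = τ ^ (m + 1 - (i : ℕ)) * τ ^ (i : ℕ) := by
        rw [← pow_add]; congr 1; omega
      rw [this, mul_pow]; ring

/-- Reduction of `u ^ k * exp (ε * u ^ 2)` to the first powers. -/
theorem exists_pow_mul_exp_reduction {ι : Type*} {m : ℕ} (u : ι → ℝ) {M : ℝ}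
    (h : ∀ k : ℕ, ∃ b : Fin (m + 1) → ℝ, (∀ i, |b i| ≤ M ^ k) ∧
        ∀ j, u j ^ k = ∑ i : Fin (m + 1), b i * u j ^ (i : ℕ))
    (ε : ℝ) (hε : |ε| = 1) (k : ℕ) :
    ∃ b : Fin (m + 1) → ℝ, (∀ i, |b i| ≤ M ^ k * Real.exp (M ^ 2)) ∧
        ∀ j, u j ^ k * Real.exp (ε * u j ^ 2) = ∑ i : Fin (m + 1), b i * u j ^ (i : ℕ) := by
  choose b hb hbu using h
  -- In the exponential series the term `u ^ (k + 2 * l) / l !` reduces with coefficients at most `M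
  -- ^ (k + 2 * l) / l !`, and these sum to `M ^ k * exp (M ^ 2)`.
  have hE : HasSum (fun l : ℕ => M ^ k * ((M ^ 2) ^ l / l.factorial))
      (M ^ k * Real.exp (M ^ 2)) := by
    rw [Real.exp_eq_exp_ℝ]
    exact (NormedSpace.expSeries_div_hasSum_exp (M ^ 2)).mul_left _
  have hbound : ∀ i l, ‖b (k + 2 * l) i * (ε ^ l / l.factorial)‖
      ≤ M ^ k * ((M ^ 2) ^ l / l.factorial) := fun i l => by
    rw [norm_mul, norm_div, norm_pow, Real.norm_eq_abs ε, hε, one_pow, Real.norm_eq_abs,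
      Real.norm_eq_abs, Nat.abs_cast]
    calc _ ≤ M ^ (k + 2 * l) * (1 / l.factorial) := by gcongr; exact hb _ _
      _ = _ := by rw [pow_add, pow_mul]; ring
  have hsum : ∀ i, Summable fun l => b (k + 2 * l) i * (ε ^ l / l.factorial) := fun i =>
    Summable.of_norm_bounded hE.summable (hbound i)
  refine ⟨fun i => ∑' l, b (k + 2 * l) i * (ε ^ l / l.factorial), fun i => ?_, fun j => ?_⟩
  · have := tsum_of_norm_bounded hE (hbound i)
    simpa using this
  · have h1 : HasSum (fun l : ℕ => u j ^ k * ((ε * u j ^ 2) ^ l / l.factorial))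
        (u j ^ k * Real.exp (ε * u j ^ 2)) := by
      rw [Real.exp_eq_exp_ℝ]
      exact (NormedSpace.expSeries_div_hasSum_exp (ε * u j ^ 2)).mul_left _
    have h2 : HasSum (fun l : ℕ => ∑ i : Fin (m + 1),
        b (k + 2 * l) i * (ε ^ l / l.factorial) * u j ^ (i : ℕ))
        (∑ i : Fin (m + 1), (∑' l, b (k + 2 * l) i * (ε ^ l / l.factorial)) * u j ^ (i : ℕ)) :=
      hasSum_sum fun i _ => (hsum i).hasSum.mul_right _
    refine h1.unique ?_
    convert h2 using 2 with l
    have : u j ^ k * ((ε * u j ^ 2) ^ l / l.factorial)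
        = u j ^ (k + 2 * l) * (ε ^ l / l.factorial) := by
      rw [pow_add, pow_mul, mul_pow]; ring
    rw [this, hbu, Finset.sum_mul]
    exact Finset.sum_congr rfl fun i _ => by ring

end PowerReduction

/-! ### Gaussian kernels with small scale parameter -/

theorem sq_dotProduct_le_of_eq_sum {ι κ : Type*} [Fintype ι] [Fintype κ] {v : ι → ℝ}
    {w : κ → ι → ℝ} {b : κ → ℝ} (h : ∀ i, v i = ∑ k, b k * w k i) (a : ι → ℝ) :
    (v ⬝ᵥ a) ^ 2 ≤ (∑ k, b k ^ 2) * ∑ k, (w k ⬝ᵥ a) ^ 2 := by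
  have : v ⬝ᵥ a = ∑ k, b k * (w k ⬝ᵥ a) := by
    simp only [dotProduct, h, Finset.sum_mul, Finset.mul_sum]
    rw [Finset.sum_comm]
    exact Finset.sum_congr rfl fun i _ => Finset.sum_congr rfl fun j _ => by ring
  rw [this]
  exact Finset.sum_mul_sq_le_sq_mul_sq _ _ _

/-- The Gaussian kernel on the nodes `x`. -/
noncomputable def gaussKernel {ι : Type*} (x : ι → ℝ) (s : ℝ) : ι → ι → ℝ :=
  fun i j => Real.exp (-(s * (x i - x j) ^ 2))

/-- Completing the square leaves `exp (2 * (τ * x i) * (τ * x j))` between two one-variable factors;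
its power series is a sum of squares of linear forms. -/
theorem hasSum_quadForm_gaussKernel {ι : Type*} [Fintype ι] (x : ι → ℝ) (τ : ℝ) (a : ι → ℝ) :
    HasSum (fun k : ℕ => 2 ^ k / (k.factorial : ℝ) *
        ((fun i => (τ * x i) ^ k) ⬝ᵥ fun i => Real.exp (-(τ * x i) ^ 2) * a i) ^ 2)
      (quadForm (gaussKernel x (τ ^ 2)) a) := by
  have key : ∀ i j, HasSum (fun k : ℕ => 2 ^ k / (k.factorial : ℝ) *
      (((τ * x i) ^ k * (Real.exp (-(τ * x i) ^ 2) * a i)) *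
        ((τ * x j) ^ k * (Real.exp (-(τ * x j) ^ 2) * a j))))
      (a i * a j * gaussKernel x (τ ^ 2) i j) := fun i j => by
    have h := (NormedSpace.expSeries_div_hasSum_exp (2 * (τ * x i) * (τ * x j))).mul_left
      (a i * a j * (Real.exp (-(τ * x i) ^ 2) * Real.exp (-(τ * x j) ^ 2)))
    rw [← Real.exp_eq_exp_ℝ] at h
    have e : a i * a j * gaussKernel x (τ ^ 2) i j = a i * a j * (Real.exp (-(τ * x i) ^ 2)
        * Real.exp (-(τ * x j) ^ 2)) * Real.exp (2 * (τ * x i) * (τ * x j)) := by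
      rw [gaussKernel, mul_assoc, mul_assoc, mul_assoc, ← Real.exp_add, ← Real.exp_add]
      congr 3; ring_nf
    rw [e]
    refine Eq.mp (congrArg (fun f => HasSum f _) (funext fun k => ?_)) h
    rw [mul_pow, mul_pow]; ring
  have := hasSum_sum (s := Finset.univ) fun i _ =>
    hasSum_sum (s := Finset.univ) fun j _ => key i j
  unfold quadForm
  convert this using 2 with k
  rw [sq, dotProduct, Finset.sum_mul_sum, Finset.mul_sum]
  exact Finset.sum_congr rfl fun i _ => by rw [Finset.mul_sum]

theorem quadForm_gaussKernel_nonneg {ι : Type*} [Fintype ι] (x : ι → ℝ) {s : ℝ} (hs : 0 ≤ s)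
    (a : ι → ℝ) : 0 ≤ quadForm (gaussKernel x s) a := by
  have := hasSum_quadForm_gaussKernel x (Real.sqrt s) a
  rw [Real.sq_sqrt hs] at this
  exact this.nonneg fun k => by positivity

/-- On `m + 1` nodes all higher powers of `τ * x`, with `τ ^ 2 = s`, are combinations of the first
`m + 1`, with coefficients controlled uniformly in `τ ≤ 1`. So the first terms of the series for the
kernel dominate the rest, however close to singular the kernel is. -/
theorem exists_gaussKernel_bounds_of_le_one {m : ℕ} (x : Fin (m + 1) → ℝ) :
    ∃ c C : ℝ, 0 < c ∧ 0 < C ∧ ∀ s : ℝ, 0 ≤ s → s ≤ 1 → ∀ a,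
      c * ∑ i : Fin (m + 1), s ^ (i : ℕ) * ((fun j => x j ^ (i : ℕ)) ⬝ᵥ a) ^ 2
          ≤ quadForm (gaussKernel x s) a ∧
      quadForm (gaussKernel x s) a ≤
        C * ∑ i : Fin (m + 1), s ^ (i : ℕ) * ((fun j => x j ^ (i : ℕ)) ⬝ᵥ a) ^ 2 := by
  obtain ⟨M, hM, hred⟩ := exists_uniform_pow_reduction x
  have hM0 : 0 ≤ M := by linarith
  set N : ℝ := (m : ℝ) + 1 with hN
  have hN0 : 0 < N := by positivity
  -- coefficient bound for the squares
  have hsq : ∀ (k : ℕ) (b : Fin (m + 1) → ℝ), (∀ i, |b i| ≤ M ^ k * Real.exp (M ^ 2)) →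
      ∑ i, b i ^ 2 ≤ N * (M ^ k * Real.exp (M ^ 2)) ^ 2 := fun k b hb => by
    calc _ ≤ ∑ _i : Fin (m + 1), (M ^ k * Real.exp (M ^ 2)) ^ 2 :=
          Finset.sum_le_sum fun i _ => by
            rw [← sq_abs]; exact pow_le_pow_left₀ (abs_nonneg _) (hb i) 2
      _ = _ := by simp [hN]
  -- The outer `N` counts the linear forms, the inner factor bounds their coefficients, and `m !`
  -- compensates the weights `2 ^ k / k !` of the first `m + 1` terms.
  set D : ℝ := N * (N * (M ^ m * Real.exp (M ^ 2)) ^ 2 * (m.factorial : ℝ)) with hD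
  have hD0 : 0 < D := by positivity
  refine ⟨D⁻¹, N * Real.exp (M ^ 2) ^ 2 * Real.exp (2 * M ^ 2), by positivity, by positivity,
    fun s hs0 hs1 a => ?_⟩
  set τ := Real.sqrt s with hτ
  have hτs : τ ^ 2 = s := Real.sq_sqrt hs0
  have hτ0 : 0 ≤ τ := Real.sqrt_nonneg _
  have hτ1 : τ ≤ 1 := by rw [hτ]; exact Real.sqrt_le_one.mpr hs1
  have hpow : ∀ i : Fin (m + 1), s ^ (i : ℕ) * ((fun j => x j ^ (i : ℕ)) ⬝ᵥ a) ^ 2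
      = ((fun j => (τ * x j) ^ (i : ℕ)) ⬝ᵥ a) ^ 2 := fun i => by
    have : (fun j => (τ * x j) ^ (i : ℕ)) = τ ^ (i : ℕ) • fun j => x j ^ (i : ℕ) := by
      ext j; simp [mul_pow]
    rw [this, smul_dotProduct, smul_eq_mul, mul_pow, ← hτs, ← pow_mul, ← pow_mul, mul_comm 2]
  simp only [hpow]
  have hQ := hasSum_quadForm_gaussKernel x τ a
  rw [hτs] at hQ
  set e : Fin (m + 1) → ℝ := fun i => Real.exp (-(τ * x i) ^ 2) * a i with he
  have hterm : ∀ k : ℕ, 0 ≤ 2 ^ k / (k.factorial : ℝ) *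
        ((fun i => (τ * x i) ^ k) ⬝ᵥ e) ^ 2 := fun k => by positivity
  constructor
  · rw [inv_mul_le_iff₀ hD0]
    -- The Gaussian factor inside `e` is undone by `exp ((τ * x j) ^ 2)`, which the reduction
    -- absorbs with sign `1`; the upper bound uses the sign `-1`.
    have h1 : ∀ i : Fin (m + 1), ((fun j => (τ * x j) ^ (i : ℕ)) ⬝ᵥ a) ^ 2 ≤
        N * (M ^ m * Real.exp (M ^ 2)) ^ 2 *
          ∑ i : Fin (m + 1), ((fun j => (τ * x j) ^ (i : ℕ)) ⬝ᵥ e) ^ 2 := fun i => by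
      obtain ⟨b, hb, hbu⟩ := exists_pow_mul_exp_reduction (fun j => τ * x j)
        (hred τ hτ0 hτ1) 1 (by simp) i
      have e1 : (fun j => (τ * x j) ^ (i : ℕ)) ⬝ᵥ a
          = (fun j => (τ * x j) ^ (i : ℕ) * Real.exp (1 * (τ * x j) ^ 2)) ⬝ᵥ e := by
        simp only [dotProduct, he]
        refine Finset.sum_congr rfl fun j _ => ?_
        have : Real.exp (1 * (τ * x j) ^ 2) * Real.exp (-(τ * x j) ^ 2) = 1 := by
          rw [← Real.exp_add]; simp
        linear_combination -(τ * x j) ^ (i : ℕ) * a j * this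
      rw [e1]
      refine (sq_dotProduct_le_of_eq_sum hbu e).trans ?_
      gcongr
      refine (hsq i b hb).trans ?_
      gcongr
      omega
    have h2 : ∑ i : Fin (m + 1), ((fun j => (τ * x j) ^ (i : ℕ)) ⬝ᵥ e) ^ 2 ≤
        m.factorial * quadForm (gaussKernel x s) a := by
      have h3 := sum_le_hasSum (Finset.range (m + 1)) (fun k _ => hterm k) hQ
      rw [Finset.sum_range] at h3
      refine le_trans ?_ (mul_le_mul_of_nonneg_left h3 (by positivity))
      rw [Finset.mul_sum]
      refine Finset.sum_le_sum fun i _ => ?_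
      rw [← mul_assoc]
      refine le_mul_of_one_le_left (by positivity) ?_
      have : ((i : ℕ).factorial : ℝ) ≤ m.factorial := by
        exact_mod_cast Nat.factorial_le (by omega)
      have hf : (0 : ℝ) < (i : ℕ).factorial := by positivity
      have h2 : (1 : ℝ) ≤ 2 ^ (i : ℕ) := one_le_pow₀ (by norm_num)
      rw [mul_div_assoc', le_div_iff₀ hf]
      nlinarith
    calc _ ≤ ∑ _i : Fin (m + 1), N * (M ^ m * Real.exp (M ^ 2)) ^ 2 *
          ∑ i : Fin (m + 1), ((fun j => (τ * x j) ^ (i : ℕ)) ⬝ᵥ e) ^ 2 :=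
          Finset.sum_le_sum fun i _ => h1 i
      _ = N * (N * (M ^ m * Real.exp (M ^ 2)) ^ 2) *
          ∑ i : Fin (m + 1), ((fun j => (τ * x j) ^ (i : ℕ)) ⬝ᵥ e) ^ 2 := by
          simp [hN]; ring
      _ ≤ N * (N * (M ^ m * Real.exp (M ^ 2)) ^ 2) *
          (m.factorial * quadForm (gaussKernel x s) a) := by gcongr
      _ = _ := by rw [hD]; ring
  · set T := ∑ i : Fin (m + 1), ((fun j => (τ * x j) ^ (i : ℕ)) ⬝ᵥ a) ^ 2 with hT
    have hT0 : 0 ≤ T := Finset.sum_nonneg fun i _ => sq_nonneg _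
    have h1 : ∀ k : ℕ, ((fun j => (τ * x j) ^ k) ⬝ᵥ e) ^ 2 ≤
        N * (M ^ k * Real.exp (M ^ 2)) ^ 2 * T := fun k => by
      obtain ⟨b, hb, hbu⟩ := exists_pow_mul_exp_reduction (fun j => τ * x j)
        (hred τ hτ0 hτ1) (-1) (by simp) k
      have e1 : (fun j => (τ * x j) ^ k) ⬝ᵥ e
          = (fun j => (τ * x j) ^ k * Real.exp (-1 * (τ * x j) ^ 2)) ⬝ᵥ a := by
        simp only [dotProduct, he]
        refine Finset.sum_congr rfl fun j _ => ?_
        rw [neg_one_mul]; ring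
      rw [e1]
      refine (sq_dotProduct_le_of_eq_sum hbu a).trans ?_
      gcongr
      exact hsq k b hb
    have hE : HasSum (fun k : ℕ => N * Real.exp (M ^ 2) ^ 2 * T *
        ((2 * M ^ 2) ^ k / (k.factorial : ℝ)))
        (N * Real.exp (M ^ 2) ^ 2 * T * Real.exp (2 * M ^ 2)) := by
      have := (NormedSpace.expSeries_div_hasSum_exp (2 * M ^ 2)).mul_left
        (N * Real.exp (M ^ 2) ^ 2 * T)
      rwa [← Real.exp_eq_exp_ℝ] at this
    refine (hasSum_le (fun k => ?_) hQ hE).trans (le_of_eq (by ring))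
    calc _ ≤ 2 ^ k / (k.factorial : ℝ) * (N * (M ^ k * Real.exp (M ^ 2)) ^ 2 * T) := by
          gcongr; exact h1 k
      _ = _ := by rw [mul_pow 2, ← pow_mul, mul_comm 2 k, pow_mul]; ring

/-! ### Framing of Gaussian kernels of every scale -/

/-- Symmetric kernels whose quadratic form is comparable, up to the factor `K`, to a nonnegative
combination of the squares of the linear forms `w k`. -/
def IsFramed {ι κ : Type*} [Fintype ι] [Fintype κ] (w : κ → ι → ℝ) (K : ℝ) (M : ι → ι → ℝ) :
    Prop :=
  (∀ i j, M i j = M j i) ∧ ∃ t : κ → ℝ, (∀ k, 0 ≤ t k) ∧ ∀ a,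
    ∑ k, t k * (w k ⬝ᵥ a) ^ 2 ≤ quadForm M a ∧ quadForm M a ≤ K * ∑ k, t k * (w k ⬝ᵥ a) ^ 2

section QuadForm

variable {ι : Type*} [Fintype ι]

theorem quadForm_eq_dotProduct (M : ι → ι → ℝ) (a : ι → ℝ) :
    quadForm M a = a ⬝ᵥ (Matrix.of M *ᵥ a) := by
  simp only [quadForm, dotProduct, mulVec, Finset.mul_sum, Matrix.of_apply]
  exact Finset.sum_congr rfl fun i _ => Finset.sum_congr rfl fun j _ => by ring

theorem quadForm_add (M N : ι → ι → ℝ) (a : ι → ℝ) :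
    quadForm (M + N) a = quadForm M a + quadForm N a := by
  simp [quadForm, mul_add, Finset.sum_add_distrib]

theorem quadForm_sub (M N : ι → ι → ℝ) (a : ι → ℝ) :
    quadForm (M - N) a = quadForm M a - quadForm N a := by
  simp [quadForm, mul_sub, Finset.sum_sub_distrib]

theorem quadForm_smul (c : ℝ) (M : ι → ι → ℝ) (a : ι → ℝ) :
    quadForm (c • M) a = c * quadForm M a := by
  simp only [quadForm, Finset.mul_sum, Pi.smul_apply, smul_eq_mul]
  exact Finset.sum_congr rfl fun i _ => Finset.sum_congr rfl fun j _ => by ring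

theorem quadForm_sum_sq {κ : Type*} [Fintype κ] (t : κ → ℝ) (w : κ → ι → ℝ) (a : ι → ℝ) :
    quadForm (fun i j => ∑ k, t k * (w k i * w k j)) a = ∑ k, t k * (w k ⬝ᵥ a) ^ 2 := by
  have h : ∀ k, t k * (w k ⬝ᵥ a) ^ 2 = ∑ i, ∑ j, a i * a j * (t k * (w k i * w k j)) := fun k => by
    rw [sq, dotProduct, Finset.sum_mul_sum, Finset.mul_sum]
    refine Finset.sum_congr rfl fun i _ => ?_
    rw [Finset.mul_sum]
    exact Finset.sum_congr rfl fun j _ => by ring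
  simp only [h, quadForm, Finset.mul_sum]
  rw [Finset.sum_comm]
  refine Eq.trans ?_ (Finset.sum_comm)
  rw [Finset.sum_comm]
  exact Finset.sum_congr rfl fun i _ => Finset.sum_comm

/-- Schur product theorem for quadratic forms. -/
theorem quadForm_mul_nonneg {M N : ι → ι → ℝ} (hM : ∀ i j, M i j = M j i)
    (hN : ∀ i j, N i j = N j i) (hM0 : ∀ a, 0 ≤ quadForm M a) (hN0 : ∀ a, 0 ≤ quadForm N a)
    (a : ι → ℝ) : 0 ≤ quadForm (M * N) a := by
  have psd : ∀ {L : ι → ι → ℝ}, (∀ i j, L i j = L j i) → (∀ a, 0 ≤ quadForm L a) →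
      (Matrix.of L).PosSemidef := fun {L} h h0 => by
    refine Matrix.PosSemidef.of_dotProduct_mulVec_nonneg ?_ fun a => ?_
    · ext i j; simp [h j i]
    · rw [star_trivial, ← quadForm_eq_dotProduct]; exact h0 a
  have h := (psd hM hM0).hadamard (psd hN hN0)
  rw [quadForm_eq_dotProduct]
  have := h.dotProduct_mulVec_nonneg a
  rw [star_trivial] at this
  exact this

end QuadForm

open Classical in
/-- The indicator vector of the nodes that coincide with `x j`. -/
noncomputable def fiberVec {ι : Type*} (x : ι → ℝ) (j : ι) : ι → ℝ :=
  fun i => if x i = x j then 1 else 0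

/-- The vectors that frame the Gaussian kernels with nodes `x`: the first monomials and
the indicators of the coincidence classes. -/
noncomputable def gaussFrame {m : ℕ} (x : Fin (m + 1) → ℝ) :
    Fin (m + 1) ⊕ Fin (m + 1) → Fin (m + 1) → ℝ :=
  Sum.elim (fun i j => x j ^ (i : ℕ)) (fiberVec x)

theorem gaussKernel_symm {ι : Type*} (x : ι → ℝ) (s : ℝ) (i j : ι) :
    gaussKernel x s i j = gaussKernel x s j i := by
  simp only [gaussKernel]; congr 3; ring

/-- Both families span the functions of the node value: monomials are constant on coincidence
classes, and Lagrange interpolation at the distinct values, at most `m + 1` of them, recovers the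
class indicators. -/
theorem exists_fiberVec_bounds {m : ℕ} (x : Fin (m + 1) → ℝ) :
    ∃ C : ℝ, 0 < C ∧ ∀ a,
      ∑ i : Fin (m + 1), ((fun j => x j ^ (i : ℕ)) ⬝ᵥ a) ^ 2
        ≤ C * ∑ j, (fiberVec x j ⬝ᵥ a) ^ 2 ∧
      ∑ j, (fiberVec x j ⬝ᵥ a) ^ 2
        ≤ C * ∑ i : Fin (m + 1), ((fun j => x j ^ (i : ℕ)) ⬝ᵥ a) ^ 2 := by
  classical
  have h1 : ∀ i : Fin (m + 1), ∃ b : Fin (m + 1) → ℝ,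
      ∀ l, x l ^ (i : ℕ) = ∑ j, b j * fiberVec x j l := fun i => by
    -- A class indicator is listed once for each of its members, hence the division by the size of
    -- the class.
    refine ⟨fun j => x j ^ (i : ℕ) / (Finset.univ.filter fun l => x l = x j).card, fun l => ?_⟩
    have hne : ((Finset.univ.filter fun j => x j = x l).card : ℝ) ≠ 0 := by
      have : 0 < (Finset.univ.filter fun j => x j = x l).card :=
        Finset.card_pos.mpr ⟨l, by simp⟩
      positivity
    have : ∀ j, x j ^ (i : ℕ) / (Finset.univ.filter fun l => x l = x j).card * fiberVec x j l
        = if x j = x l then x l ^ (i : ℕ) / (Finset.univ.filter fun j => x j = x l).card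
          else 0 := fun j => by
      by_cases h : x l = x j
      · simp [fiberVec, h]
      · simp [fiberVec, h, Ne.symm h]
    simp only [this]
    rw [← Finset.sum_filter, Finset.sum_const, nsmul_eq_mul]
    field_simp
  have h2 : ∀ j : Fin (m + 1), ∃ b : Fin (m + 1) → ℝ,
      ∀ l, fiberVec x j l = ∑ i : Fin (m + 1), b i * x l ^ (i : ℕ) := fun j => by
    let p := Lagrange.interpolate (Finset.univ.image x) id
      (fun v => if v = x j then (1 : ℝ) else 0)
    have hdeg : p.degree < ((m + 1 : ℕ) : WithBot ℕ) := by
      refine (Lagrange.degree_interpolate_lt _ Function.injective_id.injOn).trans_le ?_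
      exact_mod_cast Finset.card_image_le.trans (by simp)
    have hnat : p.natDegree < m + 1 := by
      by_cases hp : p = 0
      · simp [hp]
      · exact (Polynomial.natDegree_lt_iff_degree_lt hp).mpr hdeg
    refine ⟨fun i => p.coeff i, fun l => ?_⟩
    have he : p.eval (x l) = if x l = x j then (1 : ℝ) else 0 :=
      Lagrange.eval_interpolate_at_node (v := id) _ Function.injective_id.injOn
        (Finset.mem_image_of_mem x (Finset.mem_univ l))
    rw [Polynomial.eval_eq_sum_range' hnat, Finset.sum_range] at he
    rw [fiberVec, ← he]
  choose b hb using h1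
  choose d hd using h2
  refine ⟨(∑ i, ∑ j, b i j ^ 2) + (∑ i, ∑ j, d i j ^ 2) + 1, by positivity, fun a => ⟨?_, ?_⟩⟩
  · calc _ ≤ ∑ i, (∑ j, b i j ^ 2) * ∑ j, (fiberVec x j ⬝ᵥ a) ^ 2 :=
        Finset.sum_le_sum fun i _ => sq_dotProduct_le_of_eq_sum (hb i) a
      _ ≤ _ := by
        rw [← Finset.sum_mul]
        gcongr
        have : 0 ≤ ∑ i, ∑ j, d i j ^ 2 := by positivity
        linarith
  · calc _ ≤ ∑ j, (∑ i, d j i ^ 2) * ∑ i : Fin (m + 1), ((fun j => x j ^ (i : ℕ)) ⬝ᵥ a) ^ 2 :=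
        Finset.sum_le_sum fun j _ => sq_dotProduct_le_of_eq_sum (hd j) a
      _ ≤ _ := by
        rw [← Finset.sum_mul]
        gcongr
        have : 0 ≤ ∑ i, ∑ j, b i j ^ 2 := by positivity
        linarith

/-- All Gaussian kernels with given nodes are framed by the same vectors. -/
theorem exists_isFramed_gaussKernel {m : ℕ} (x : Fin (m + 1) → ℝ) :
    ∃ K : ℝ, 0 < K ∧ ∀ s : ℝ, 0 ≤ s → IsFramed (gaussFrame x) K (gaussKernel x s) := by
  obtain ⟨c, C, hc, hC, hcC⟩ := exists_gaussKernel_bounds_of_le_one x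
  obtain ⟨D, hD, hDb⟩ := exists_fiberVec_bounds x
  -- the coincidence kernel
  set J : Fin (m + 1) → Fin (m + 1) → ℝ :=
    fun i j => ∑ k, (1 : ℝ) * (fiberVec x k i * fiberVec x k j) with hJ
  have hJq : ∀ a, quadForm J a = ∑ j, (fiberVec x j ⬝ᵥ a) ^ 2 := fun a => by
    rw [hJ, quadForm_sum_sq (fun _ => 1)]; simp
  have hJs : ∀ i j, J i j = J j i := fun i j => by simp only [hJ, mul_comm]
  -- `J` vanishes off the coincidences and the Gaussian kernel is `1` on them. Thus Schur
  -- multiplication by `gaussKernel x (s - 1)` carries the comparison with `J` from `s = 1` to every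
  -- `s ≥ 1`.
  have hJg : ∀ s, J * gaussKernel x s = J := fun s => by
    ext i j
    by_cases h : x i = x j
    · simp [gaussKernel, h]
    · have : J i j = 0 := by
        refine Finset.sum_eq_zero fun k _ => ?_
        simp only [fiberVec]
        split_ifs with h1 h2 <;> simp_all
      simp [this]
  have hmul : ∀ s, gaussKernel x 1 * gaussKernel x (s - 1) = gaussKernel x s := fun s => by
    ext i j
    simp only [gaussKernel, Pi.mul_apply, ← Real.exp_add]
    congr 1; ring
  have h1 : ∀ a, c / D * quadForm J a ≤ quadForm (gaussKernel x 1) a ∧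
      quadForm (gaussKernel x 1) a ≤ C * D * quadForm J a := fun a => by
    have h := hcC 1 zero_le_one le_rfl a
    simp only [one_pow, one_mul] at h
    rw [hJq]
    refine ⟨le_trans ?_ h.1, h.2.trans ?_⟩
    · rw [div_mul_eq_mul_div, div_le_iff₀ hD, mul_assoc, mul_comm _ D]
      gcongr; exact (hDb a).2
    · rw [mul_assoc]; gcongr; exact (hDb a).1
  have hge : ∀ s, 1 ≤ s → ∀ a, c / D * quadForm J a ≤ quadForm (gaussKernel x s) a ∧
      quadForm (gaussKernel x s) a ≤ C * D * quadForm J a := fun s hs a => by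
    have hg0 := quadForm_gaussKernel_nonneg x (sub_nonneg.mpr hs)
    constructor
    · have := quadForm_mul_nonneg (M := gaussKernel x 1 - (c / D) • J)
        (N := gaussKernel x (s - 1))
        (fun i j => by simp [hJs i j, gaussKernel_symm x 1 i j]) (gaussKernel_symm x _)
        (fun a => by rw [quadForm_sub, quadForm_smul]; linarith [(h1 a).1]) hg0 a
      rw [sub_mul, smul_mul_assoc, hJg, hmul, quadForm_sub, quadForm_smul] at this
      linarith
    · have := quadForm_mul_nonneg (M := (C * D) • J - gaussKernel x 1)
        (N := gaussKernel x (s - 1))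
        (fun i j => by simp [hJs i j, gaussKernel_symm x 1 i j]) (gaussKernel_symm x _)
        (fun a => by rw [quadForm_sub, quadForm_smul]; linarith [(h1 a).2]) hg0 a
      rw [sub_mul, smul_mul_assoc, hJg, hmul, quadForm_sub, quadForm_smul] at this
      linarith
  -- The sum of the ratios of upper to lower constants on the ranges `s ≤ 1` and `s ≥ 1` serves
  -- both.
  refine ⟨C / c + C * D / (c / D), by positivity, fun s hs => ⟨gaussKernel_symm x s, ?_⟩⟩
  have hnn : 0 ≤ C / c ∧ 0 ≤ C * D / (c / D) := ⟨by positivity, by positivity⟩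
  rcases le_total s 1 with h | h
  · refine ⟨Sum.elim (fun i => c * s ^ (i : ℕ)) 0, ?_, fun a => ?_⟩
    · rintro (i | j)
      · simp; positivity
      · simp
    · have hb := hcC s hs h a
      simp only [Fintype.sum_sum_type, gaussFrame, Sum.elim_inl, Sum.elim_inr, Pi.zero_apply,
        zero_mul, Finset.sum_const_zero, add_zero, mul_assoc, ← Finset.mul_sum]
      refine ⟨hb.1, hb.2.trans ?_⟩
      have hT : 0 ≤ ∑ i : Fin (m + 1), s ^ (i : ℕ) * ((fun j => x j ^ (i : ℕ)) ⬝ᵥ a) ^ 2 := by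
        positivity
      rw [add_mul, ← mul_assoc, div_mul_cancel₀ _ hc.ne']
      have := mul_nonneg hnn.2 (mul_nonneg hc.le hT)
      linarith
  · refine ⟨Sum.elim 0 (fun _ => c / D), ?_, fun a => ?_⟩
    · rintro (i | j)
      · simp
      · simp; positivity
    · have hb := hge s h a
      simp only [Fintype.sum_sum_type, gaussFrame, Sum.elim_inl, Sum.elim_inr, Pi.zero_apply,
        zero_mul, Finset.sum_const_zero, zero_add, ← Finset.mul_sum]
      rw [← hJq]
      refine ⟨hb.1, hb.2.trans ?_⟩
      have hT : 0 ≤ quadForm J a := by rw [hJq]; positivity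
      rw [add_mul, ← mul_assoc (C * D / (c / D)), div_mul_cancel₀ _ (by positivity)]
      have := mul_nonneg hnn.1 (mul_nonneg (by positivity : 0 ≤ c / D) hT)
      linarith

/-! ### Framed kernels form a closed cone -/

section FramedCone

variable {ι κ : Type*} [Fintype ι] [Fintype κ] {w : κ → ι → ℝ} {K : ℝ}

theorem IsFramed.add {M N : ι → ι → ℝ} (hM : IsFramed w K M) (hN : IsFramed w K N) :
    IsFramed w K (M + N) := by
  obtain ⟨hMs, t, ht, hMt⟩ := hM
  obtain ⟨hNs, r, hr, hNr⟩ := hN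
  refine ⟨fun i j => by simp [hMs i j, hNs i j], t + r, fun k => add_nonneg (ht k) (hr k),
    fun a => ?_⟩
  simp only [Pi.add_apply, add_mul, Finset.sum_add_distrib, quadForm_add, mul_add]
  exact ⟨add_le_add (hMt a).1 (hNr a).1, add_le_add (hMt a).2 (hNr a).2⟩

theorem IsFramed.smul {M : ι → ι → ℝ} (hM : IsFramed w K M) {c : ℝ} (hc : 0 ≤ c) :
    IsFramed w K (c • M) := by
  obtain ⟨hMs, t, ht, hMt⟩ := hM
  refine ⟨fun i j => by simp [hMs i j], c • t, fun k => mul_nonneg hc (ht k), fun a => ?_⟩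
  simp only [Pi.smul_apply, smul_eq_mul, mul_assoc, ← Finset.mul_sum, quadForm_smul]
  refine ⟨by gcongr; exact (hMt a).1, ?_⟩
  rw [mul_left_comm]
  gcongr; exact (hMt a).2

theorem isFramed_zero : IsFramed w K (0 : ι → ι → ℝ) :=
  ⟨fun i j => by simp, 0, fun k => le_rfl, fun a => by simp [quadForm]⟩

theorem continuous_quadForm (a : ι → ℝ) : Continuous fun M : ι → ι → ℝ => quadForm M a := by
  unfold quadForm; fun_prop

/-- Evaluating the form at `w k` bounds the weight of every nonzero `w k` along a convergent
sequence, so a subsequence of the weights converges. -/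
theorem isClosed_isFramed : IsClosed {M : ι → ι → ℝ | IsFramed w K M} := by
  refine IsSeqClosed.isClosed fun M L hM hL => ?_
  choose hs t ht hMt using hM
  have hq : ∀ a, Tendsto (fun j => quadForm (M j) a) atTop (𝓝 (quadForm L a)) := fun a =>
    ((continuous_quadForm a).tendsto L).comp hL
  have hB : ∀ k, ∃ B, ∀ j, quadForm (M j) (w k) ≤ B := fun k => by
    obtain ⟨B, hB⟩ := (hq (w k)).bddAbove_range
    exact ⟨B, fun j => hB ⟨j, rfl⟩⟩
  choose B hB using hB
  classical
  have hself : ∀ k, w k ≠ 0 → 0 < (w k ⬝ᵥ w k) ^ 2 := fun k hk => by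
    have : w k ⬝ᵥ w k ≠ 0 := fun h => hk (dotProduct_self_eq_zero.mp h)
    positivity
  -- weights of vanishing vectors are irrelevant
  set r : ℕ → κ → ℝ := fun j k => if w k = 0 then 0 else t j k with hr
  have hsum : ∀ j a, ∑ k, r j k * (w k ⬝ᵥ a) ^ 2 = ∑ k, t j k * (w k ⬝ᵥ a) ^ 2 := fun j a => by
    refine Finset.sum_congr rfl fun k _ => ?_
    by_cases h : w k = 0 <;> simp [hr, h]
  have hr0 : ∀ j k, 0 ≤ r j k := fun j k => by
    by_cases h : w k = 0 <;> simp [hr, h, ht]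
  have hmem : ∀ j, r j ∈ Set.Icc (0 : κ → ℝ) fun k => |B k| / (w k ⬝ᵥ w k) ^ 2 := fun j => by
    refine ⟨fun k => hr0 j k, fun k => ?_⟩
    by_cases h : w k = 0
    · simp [hr, h]
    · rw [le_div_iff₀ (hself k h)]
      calc _ ≤ ∑ k', r j k' * (w k' ⬝ᵥ w k) ^ 2 :=
            Finset.single_le_sum (f := fun k' => r j k' * (w k' ⬝ᵥ w k) ^ 2)
              (fun k' _ => mul_nonneg (hr0 j k') (sq_nonneg _)) (Finset.mem_univ k)
        _ ≤ quadForm (M j) (w k) := by rw [hsum]; exact (hMt j _).1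
        _ ≤ |B k| := (hB k j).trans (le_abs_self _)
  obtain ⟨r', hr', φ, hφ, hlim⟩ := isCompact_Icc.tendsto_subseq hmem
  refine ⟨fun i j => ?_, r', fun k => hr'.1 k, fun a => ?_⟩
  · have h1 := (((continuous_apply j).comp (continuous_apply i)).tendsto L).comp hL
    have h2 := (((continuous_apply i).comp (continuous_apply j)).tendsto L).comp hL
    refine tendsto_nhds_unique h1 (h2.congr fun k => ?_)
    exact (hs k i j).symm
  · have hc : Continuous fun r : κ → ℝ => ∑ k, r k * (w k ⬝ᵥ a) ^ 2 := by fun_prop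
    have h1 := (hc.tendsto r').comp hlim
    have h2 := (hq a).comp hφ.tendsto_atTop
    refine ⟨le_of_tendsto_of_tendsto' h1 h2 fun j => ?_,
      le_of_tendsto_of_tendsto' h2 (h1.const_mul K) fun j => ?_⟩
    · simp only [Function.comp_apply, hsum]; exact (hMt _ a).1
    · simp only [Function.comp_apply, hsum]; exact (hMt _ a).2

end FramedCone

/-- A functional separating the integral from the cone is nonpositive on the cone, by homogeneity,
hence also at the integral. No finiteness of the measure is needed. -/
theorem integral_mem_of_isClosed_cone {Ω E : Type*} [MeasurableSpace Ω] {μ : Measure Ω}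
    [NormedAddCommGroup E] [NormedSpace ℝ E] [CompleteSpace E] {C : Set E} (hC : IsClosed C)
    (hadd : ∀ x ∈ C, ∀ y ∈ C, x + y ∈ C) (hsmul : ∀ x ∈ C, ∀ c : ℝ, 0 ≤ c → c • x ∈ C)
    (h0 : (0 : E) ∈ C) {f : Ω → E} (hf : Integrable f μ) (hfC : ∀ᵐ ω ∂μ, f ω ∈ C) :
    ∫ ω, f ω ∂μ ∈ C := by
  by_contra hn
  have hconv : Convex ℝ C := fun x hx y hy a b ha hb _ =>
    hadd _ (hsmul x hx a ha) _ (hsmul y hy b hb)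
  obtain ⟨g, u, hgu, hug⟩ := geometric_hahn_banach_closed_point hconv hC hn
  have hu : 0 < u := by simpa using hgu 0 h0
  have hle : ∀ x ∈ C, g x ≤ 0 := fun x hx => by
    by_contra! hpos
    have := hgu _ (hsmul x hx (u / g x) (by positivity))
    rw [map_smul, smul_eq_mul, div_mul_cancel₀ _ hpos.ne'] at this
    exact lt_irrefl _ this
  have : g (∫ ω, f ω ∂μ) ≤ 0 := by
    rw [← ContinuousLinearMap.integral_comp_comm _ hf]
    exact integral_nonpos_of_ae (hfC.mono fun ω hω => hle _ hω)
  linarith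

/-! ### The closed algebra of Gaussian kernels and the power exponential family -/

section GaussAlgebra

variable {ι : Type*}

/-- The closed algebra, over the nonnegative reals and with pointwise multiplication, generated
by the Gaussian kernels with nodes `x`. -/
noncomputable def gaussAlgebra (x : ι → ℝ) : Subalgebra NNReal (ι → ι → ℝ) :=
  (Algebra.adjoin NNReal (Set.range fun s : NNReal => gaussKernel x s)).topologicalClosure

theorem isClosed_gaussAlgebra (x : ι → ℝ) : IsClosed (gaussAlgebra x : Set (ι → ι → ℝ)) :=
  Subalgebra.isClosed_topologicalClosure _

theorem gaussKernel_mem_gaussAlgebra (x : ι → ℝ) {s : ℝ} (hs : 0 ≤ s) :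
    gaussKernel x s ∈ gaussAlgebra x :=
  Subalgebra.le_topologicalClosure _ (Algebra.subset_adjoin ⟨⟨s, hs⟩, rfl⟩)

theorem smul_mem_gaussAlgebra {x : ι → ℝ} {M : ι → ι → ℝ} (hM : M ∈ gaussAlgebra x) {c : ℝ}
    (hc : 0 ≤ c) : c • M ∈ gaussAlgebra x :=
  (gaussAlgebra x).smul_mem hM (⟨c, hc⟩ : NNReal)

/-- Products of Gaussian kernels with the same nodes are Gaussian, so the algebra they generate is
just their conic span. The frame therefore survives products within one coordinate without new
vectors or a worse constant. -/
theorem IsFramed.of_mem_gaussAlgebra {κ : Type*} [Fintype κ] [Fintype ι] {x : ι → ℝ}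
    {w : κ → ι → ℝ} {K : ℝ} (h : ∀ s : ℝ, 0 ≤ s → IsFramed w K (gaussKernel x s))
    {M : ι → ι → ℝ} (hM : M ∈ gaussAlgebra x) : IsFramed w K M := by
  let S : Submonoid (ι → ι → ℝ) :=
    { carrier := Set.range fun s : NNReal => gaussKernel x s
      mul_mem' := by
        rintro _ _ ⟨s, rfl⟩ ⟨t, rfl⟩
        refine ⟨s + t, ?_⟩
        ext i j
        simp only [gaussKernel, Pi.mul_apply, ← Real.exp_add, NNReal.coe_add]
        congr 1; ring
      one_mem' := ⟨0, by ext i j; simp [gaussKernel]⟩ }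
  have hsub : (Algebra.adjoin NNReal (Set.range fun s : NNReal => gaussKernel x s) :
      Set (ι → ι → ℝ)) ⊆ {M | IsFramed w K M} := fun N hN => by
    have hN' : N ∈ Subalgebra.toSubmodule
      (Algebra.adjoin NNReal (Set.range fun s : NNReal => gaussKernel x s)) := hN
    rw [Algebra.adjoin_eq_span] at hN'
    clear hN
    induction hN' using Submodule.span_induction with
    | mem N hN =>
      obtain ⟨s, rfl⟩ := Submonoid.closure_le (S := S) |>.mpr (fun _ h => h) hN
      exact h s s.2
    | zero => exact isFramed_zero
    | add _ _ _ _ h1 h2 => exact IsFramed.add h1 h2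
    | smul c _ _ h1 => exact IsFramed.smul h1 c.2
  exact closure_minimal hsub isClosed_isFramed hM

theorem integral_mem_gaussAlgebra [Fintype ι] {Ω : Type*} [MeasurableSpace Ω] {μ : Measure Ω}
    {x : ι → ℝ} {f : Ω → ι → ι → ℝ} (hf : ∀ i j, Integrable (fun ω => f ω i j) μ)
    (hfm : ∀ᵐ ω ∂μ, f ω ∈ gaussAlgebra x) : (fun i j => ∫ ω, f ω i j ∂μ) ∈ gaussAlgebra x := by
  have hi : ∀ i, Integrable (fun ω => f ω i) μ := fun i => Integrable.of_eval (hf i)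
  have : (fun i j => ∫ ω, f ω i j ∂μ) = ∫ ω, f ω ∂μ := by
    ext i j
    rw [eval_integral hi, eval_integral (hf i)]
  rw [this]
  exact integral_mem_of_isClosed_cone (isClosed_gaussAlgebra x)
    (fun _ h1 _ h2 => add_mem h1 h2) (fun _ h _ hc => smul_mem_gaussAlgebra h hc)
    (zero_mem _) (Integrable.of_eval hi) hfm

theorem exp_mem_gaussAlgebra {x : ι → ℝ} {M : ι → ι → ℝ} (hM : M ∈ gaussAlgebra x) :
    (fun i j => Real.exp (M i j)) ∈ gaussAlgebra x := by
  refine (isClosed_gaussAlgebra x).mem_of_tendsto (b := atTop)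
    (f := fun N : ℕ => ∑ k ∈ Finset.range N, (1 / (k.factorial : ℝ)) • M ^ k) ?_
    (Eventually.of_forall fun N => sum_mem fun k _ =>
      smul_mem_gaussAlgebra (pow_mem hM k) (by positivity))
  refine tendsto_pi_nhds.mpr fun i => tendsto_pi_nhds.mpr fun j => ?_
  have := (NormedSpace.expSeries_div_hasSum_exp (M i j)).tendsto_sum_nat
  rw [← Real.exp_eq_exp_ℝ] at this
  refine this.congr fun N => ?_
  simp only [Finset.sum_apply, Pi.smul_apply, Pi.pow_apply, smul_eq_mul]
  exact Finset.sum_congr rfl fun k _ => by ring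

/-- The reciprocal is the Laplace integral of `exp (-u * (t + ρ * d ^ 2))` over `u > 0`, a mixture
of Gaussian kernels. -/
theorem resolvent_mem_gaussAlgebra [Fintype ι] (x : ι → ℝ) {t ρ : ℝ} (ht : 0 < t) (hρ : 0 ≤ ρ) :
    (fun i j => (t + ρ * (x i - x j) ^ 2)⁻¹) ∈ gaussAlgebra x := by
  have hpos : ∀ i j, 0 < t + ρ * (x i - x j) ^ 2 := fun i j => by positivity
  have e : ∀ i j, (t + ρ * (x i - x j) ^ 2)⁻¹
      = ∫ u in Set.Ioi (0 : ℝ), (Real.exp (-(u * t)) • gaussKernel x (u * ρ)) i j := fun i j => by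
    have h := integral_exp_mul_Ioi (a := -(t + ρ * (x i - x j) ^ 2))
      (by linarith [hpos i j]) 0
    rw [mul_zero, Real.exp_zero, neg_div_neg_eq, one_div] at h
    rw [← h]
    refine integral_congr_ae (Eventually.of_forall fun u => ?_)
    simp only [gaussKernel, Pi.smul_apply, smul_eq_mul, ← Real.exp_add]
    congr 1; ring
  simp only [e]
  refine integral_mem_gaussAlgebra (fun i j => ?_) ?_
  · refine (integrableOn_exp_mul_Ioi (a := -(t + ρ * (x i - x j) ^ 2))
      (by linarith [hpos i j]) 0).congr (Eventually.of_forall fun u => ?_)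
    simp only [gaussKernel, Pi.smul_apply, smul_eq_mul, ← Real.exp_add]
    congr 1; ring
  · filter_upwards [ae_restrict_mem measurableSet_Ioi] with u hu
    exact smul_mem_gaussAlgebra (gaussKernel_mem_gaussAlgebra x (mul_nonneg (le_of_lt hu) hρ))
      (Real.exp_nonneg _)

/-- The kernels `ψ` such that all `exp (-s * ψ)`, `s ≥ 0`, belong to the Gaussian algebra. -/
def gaussExponents (x : ι → ℝ) : Set (ι → ι → ℝ) :=
  {ψ | ∀ s : ℝ, 0 ≤ s → (fun i j => Real.exp (-(s * ψ i j))) ∈ gaussAlgebra x}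

theorem isClosed_gaussExponents (x : ι → ℝ) : IsClosed (gaussExponents x) := by
  have : gaussExponents x = ⋂ s : ℝ, ⋂ _ : 0 ≤ s,
      (fun ψ : ι → ι → ℝ => fun i j => Real.exp (-(s * ψ i j))) ⁻¹' (gaussAlgebra x) := by
    ext ψ; simp [gaussExponents]
  rw [this]
  refine isClosed_iInter fun s => isClosed_iInter fun _ => (isClosed_gaussAlgebra x).preimage ?_
  fun_prop

/-- The power `r ^ θ` is a positive mixture over `t` of `t ^ θ * (t⁻¹ - (t + r)⁻¹)`. For each `t`,
the exponential of a negative multiple is a positive constant times the exponential of a resolvent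
kernel, which lies in the algebra; and the exponents form a closed cone. -/
theorem rpow_sq_mem_gaussExponents [Fintype ι] (x : ι → ℝ) {θ ρ : ℝ} (hθ : θ ∈ Set.Ioo 0 1)
    (hρ : 0 ≤ ρ) : (fun i j => (ρ * (x i - x j) ^ 2) ^ θ) ∈ gaussExponents x := by
  have hadd : ∀ φ ∈ gaussExponents x, ∀ ψ ∈ gaussExponents x, φ + ψ ∈ gaussExponents x :=
    fun φ hφ ψ hψ s hs => by
      have : (fun i j => Real.exp (-(s * (φ + ψ) i j)))
          = (fun i j => Real.exp (-(s * φ i j))) * fun i j => Real.exp (-(s * ψ i j)) := by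
        ext i j
        simp only [Pi.mul_apply, Pi.add_apply, ← Real.exp_add]; congr 1; ring
      rw [this]; exact mul_mem (hφ s hs) (hψ s hs)
  have hsmul : ∀ ψ ∈ gaussExponents x, ∀ c : ℝ, 0 ≤ c → c • ψ ∈ gaussExponents x :=
    fun ψ hψ c hc s hs => by
      simpa [mul_assoc] using hψ (s * c) (mul_nonneg hs hc)
  have h0 : (0 : ι → ι → ℝ) ∈ gaussExponents x := fun s hs => by
    simp only [Pi.zero_apply, mul_zero, neg_zero, Real.exp_zero]
    exact one_mem (gaussAlgebra x)
  have hx : ∀ i j, 0 ≤ ρ * (x i - x j) ^ 2 := fun i j => by positivity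
  have e : (fun i j => (ρ * (x i - x j) ^ 2) ^ θ)
      = (∫ t in Set.Ioi 0, Real.rpowIntegrand₀₁ θ t 1)⁻¹ •
        ∫ t in Set.Ioi 0, fun i j => Real.rpowIntegrand₀₁ θ t (ρ * (x i - x j) ^ 2) := by
    ext i j
    rw [Pi.smul_apply, Pi.smul_apply, eval_integral, eval_integral, smul_eq_mul]
    · exact Real.rpow_eq_const_mul_integral hθ (hx i j)
    · exact fun j => Real.integrableOn_rpowIntegrand₀₁_Ioi hθ (hx i j)
    · exact fun i => Integrable.of_eval fun j => Real.integrableOn_rpowIntegrand₀₁_Ioi hθ (hx i j)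
  rw [e]
  refine hsmul _ ?_ _ (inv_nonneg.mpr (Real.integral_rpowIntegrand₀₁_one_pos hθ).le)
  refine integral_mem_of_isClosed_cone (isClosed_gaussExponents x) hadd hsmul h0
    (Integrable.of_eval fun i => Integrable.of_eval fun j =>
      Real.integrableOn_rpowIntegrand₀₁_Ioi hθ (hx i j)) ?_
  filter_upwards [ae_restrict_mem measurableSet_Ioi] with t ht s hs
  have ht : (0 : ℝ) < t := ht
  have : (fun i j => Real.exp (-(s * Real.rpowIntegrand₀₁ θ t (ρ * (x i - x j) ^ 2))))
      = Real.exp (-(s * (t ^ θ * t⁻¹))) •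
        fun i j => Real.exp (((s * t ^ θ) • fun i j => (t + ρ * (x i - x j) ^ 2)⁻¹) i j) := by
    ext i j
    simp only [Real.rpowIntegrand₀₁, Pi.smul_apply, smul_eq_mul, ← Real.exp_add]
    congr 1; ring
  rw [this]
  exact smul_mem_gaussAlgebra (exp_mem_gaussAlgebra (smul_mem_gaussAlgebra
    (resolvent_mem_gaussAlgebra x ht hρ) (by positivity))) (Real.exp_nonneg _)

theorem powerExponential_mem_gaussAlgebra [Fintype ι] (x : ι → ℝ) {α γ : ℝ} (hα : 0 < α)
    (hα2 : α ≤ 2) (hγ : 0 < γ) :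
    (fun i j => (CorrFamily.powerExponential α).corr γ |x i - x j|) ∈ gaussAlgebra x := by
  have e : ∀ i j, (|x i - x j| / γ) ^ α = ((γ ^ 2)⁻¹ * (x i - x j) ^ 2) ^ (α / 2) := fun i j => by
    rw [← sq_abs (x i - x j), ← inv_pow, ← mul_pow, ← Real.rpow_natCast,
      ← Real.rpow_mul (by positivity)]
    congr 1
    · field_simp
    · push_cast; ring
  simp only [CorrFamily.corr, e]
  rcases hα2.eq_or_lt with rfl | h2
  · convert gaussKernel_mem_gaussAlgebra x (s := (γ ^ 2)⁻¹) (by positivity) using 1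
    ext i j; simp [gaussKernel]
  · simpa using rpow_sq_mem_gaussExponents x (θ := α / 2) (ρ := (γ ^ 2)⁻¹)
      ⟨by linarith, by linarith⟩ (by positivity) 1 zero_le_one

end GaussAlgebra

/-! ### The Matérn correlation as a mixture of Gaussian correlations -/

section Matern

/-- The Matérn correlation at scaled distance `r`, as a Gamma mixture of Gaussian
correlations. -/
noncomputable def maternProfile (α r : ℝ) : ℝ :=
  (Real.Gamma α)⁻¹ *
    ∫ u in Set.Ioi (0 : ℝ), Real.exp (-u) * u ^ (α - 1) * Real.exp (-(r ^ 2 / (4 * u)))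

theorem integrableOn_maternProfile {α : ℝ} (hα : 0 < α) (r : ℝ) :
    IntegrableOn (fun u => Real.exp (-u) * u ^ (α - 1) * Real.exp (-(r ^ 2 / (4 * u))))
      (Set.Ioi (0 : ℝ)) := by
  refine Integrable.mono (Real.GammaIntegral_convergent hα) ?_ ?_
  · refine ContinuousOn.aestronglyMeasurable ?_ measurableSet_Ioi
    intro u hu
    have hu : (0 : ℝ) < u := hu
    refine ContinuousAt.continuousWithinAt ?_
    have : ContinuousAt (fun u : ℝ => u ^ (α - 1)) u :=
      Real.continuousAt_rpow_const _ _ (Or.inl hu.ne')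
    have h2 : ContinuousAt (fun u : ℝ => r ^ 2 / (4 * u)) u :=
      continuousAt_const.div (by fun_prop) (by positivity)
    fun_prop
  · filter_upwards [ae_restrict_mem measurableSet_Ioi] with u hu
    have hu : (0 : ℝ) < u := hu
    rw [norm_mul]
    refine mul_le_of_le_one_right (norm_nonneg _) ?_
    rw [Real.norm_eq_abs, Real.abs_exp, Real.exp_le_one_iff]
    have : 0 ≤ r ^ 2 / (4 * u) := by positivity
    linarith

theorem maternProfile_zero {α : ℝ} (hα : 0 < α) : maternProfile α 0 = 1 := by
  have hΓ := (Real.Gamma_pos_of_pos hα).ne'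
  simp [maternProfile, ← Real.Gamma_eq_integral hα, hΓ]

theorem maternProfile_antitone {α : ℝ} (hα : 0 < α) {r s : ℝ} (hr : 0 ≤ r) (hrs : r ≤ s) :
    maternProfile α s ≤ maternProfile α r := by
  have hΓ := Real.Gamma_pos_of_pos hα
  refine mul_le_mul_of_nonneg_left ?_ (inv_nonneg.mpr hΓ.le)
  refine setIntegral_mono_on (integrableOn_maternProfile hα s) (integrableOn_maternProfile hα r)
    measurableSet_Ioi fun u hu => ?_
  have hu : (0 : ℝ) < u := hu
  gcongr

theorem setIntegral_Ioi_pos {f : ℝ → ℝ} (hf : IntegrableOn f (Set.Ioi 0))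
    (hpos : ∀ u, 0 < u → 0 < f u) : 0 < ∫ u in Set.Ioi (0 : ℝ), f u := by
  rw [setIntegral_pos_iff_support_of_nonneg_ae _ hf]
  · have : Set.Ioi (0 : ℝ) ⊆ Function.support f ∩ Set.Ioi 0 := fun u hu => ⟨(hpos u hu).ne', hu⟩
    refine lt_of_lt_of_le ?_ (measure_mono this)
    simp
  · filter_upwards [ae_restrict_mem measurableSet_Ioi] with u hu
    exact (hpos u hu).le

theorem maternProfile_pos {α : ℝ} (hα : 0 < α) (r : ℝ) : 0 < maternProfile α r := by
  refine mul_pos (inv_pos.mpr (Real.Gamma_pos_of_pos hα))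
    (setIntegral_Ioi_pos (integrableOn_maternProfile hα r) fun u hu => by positivity)

theorem maternProfile_lt_one {α : ℝ} (hα : 0 < α) {r : ℝ} (hr : 0 < r) :
    maternProfile α r < 1 := by
  have hΓ := Real.Gamma_pos_of_pos hα
  have h := setIntegral_Ioi_pos
    ((integrableOn_maternProfile hα 0).sub (integrableOn_maternProfile hα r)) fun u hu => by
      have h1 : Real.exp (-(r ^ 2 / (4 * u))) < Real.exp (-(0 ^ 2 / (4 * u))) := by
        rw [Real.exp_lt_exp]
        have : 0 < r ^ 2 / (4 * u) := by positivity
        simpa using this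
      have h2 : 0 < Real.exp (-u) * u ^ (α - 1) := by positivity
      simp only [Pi.sub_apply, ← mul_sub]
      exact mul_pos h2 (sub_pos.mpr h1)
  simp only [Pi.sub_apply] at h
  rw [integral_sub (integrableOn_maternProfile hα 0) (integrableOn_maternProfile hα r)] at h
  rw [← maternProfile_zero hα]
  exact mul_lt_mul_of_pos_left (sub_pos.mp h) (inv_pos.mpr hΓ)

theorem tendsto_maternProfile_atTop {α : ℝ} (hα : 0 < α) :
    Tendsto (maternProfile α) atTop (𝓝 0) := by
  have h : Tendsto (fun r : ℝ => ∫ u in Set.Ioi (0 : ℝ),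
      Real.exp (-u) * u ^ (α - 1) * Real.exp (-(r ^ 2 / (4 * u)))) atTop
      (𝓝 (∫ _u in Set.Ioi (0 : ℝ), (0 : ℝ))) := by
    refine tendsto_integral_filter_of_dominated_convergence
      (fun u => Real.exp (-u) * u ^ (α - 1)) (Eventually.of_forall fun r =>
        (integrableOn_maternProfile hα r).aestronglyMeasurable)
      (Eventually.of_forall fun r => ?_) (Real.GammaIntegral_convergent hα) ?_
    · filter_upwards [ae_restrict_mem measurableSet_Ioi] with u hu
      have hu : (0 : ℝ) < u := hu
      rw [Real.norm_of_nonneg (by positivity)]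
      refine mul_le_of_le_one_right (by positivity) ?_
      rw [Real.exp_le_one_iff]
      have : 0 ≤ r ^ 2 / (4 * u) := by positivity
      linarith
    · filter_upwards [ae_restrict_mem measurableSet_Ioi] with u hu
      have hu : (0 : ℝ) < 4 * u := by have : (0 : ℝ) < u := hu; linarith
      have h1 : Tendsto (fun r : ℝ => r ^ 2 / (4 * u)) atTop atTop :=
        (tendsto_pow_atTop two_ne_zero).atTop_div_const hu
      simpa using (Real.tendsto_exp_neg_atTop_nhds_zero.comp h1).const_mul
        (Real.exp (-u) * u ^ (α - 1))
  have h' := h.const_mul (Real.Gamma α)⁻¹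
  rw [integral_zero, mul_zero] at h'
  exact h'

/-- The substitution `u = z / 2 * exp t` turns `u + z ^ 2 / (4 * u)` into `z * cosh t`. -/
theorem maternProfile_eq_besselK {α z : ℝ} (hα : 0 < α) (hz : 0 < z) :
    1 / ((2 : ℝ) ^ (α - 1) * Real.Gamma α) * z ^ α * besselK α z = maternProfile α z := by
  set g : ℝ → ℝ := fun u => Real.exp (-u) * u ^ (α - 1) * Real.exp (-(z ^ 2 / (4 * u))) with hg
  set f : ℝ → ℝ := fun t => z / 2 * Real.exp t with hf
  set F : ℝ → ℝ := fun t => Real.exp (-z * Real.cosh t) * Real.exp (α * t) with hF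
  have himg : f '' Set.univ = Set.Ioi 0 := by
    ext u
    simp only [hf, Set.image_univ, Set.mem_range, Set.mem_Ioi]
    constructor
    · rintro ⟨t, rfl⟩; positivity
    · intro hu
      refine ⟨Real.log (u / (z / 2)), ?_⟩
      rw [Real.exp_log (by positivity)]; field_simp
  have hder : ∀ t ∈ Set.univ, HasDerivWithinAt f (z / 2 * Real.exp t) Set.univ t := fun t _ =>
    ((Real.hasDerivAt_exp t).const_mul (z / 2)).hasDerivWithinAt
  have hinj : Set.InjOn f Set.univ := fun s _ t _ h => by
    have : Real.exp s = Real.exp t := mul_left_cancel₀ (by positivity : z / 2 ≠ 0) h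
    exact Real.exp_injective this
  have hfun : (fun t => |z / 2 * Real.exp t| • g (f t)) = fun t => (z / 2) ^ α * F t := by
    funext t
    have hpos : 0 < z / 2 * Real.exp t := by positivity
    have h1 : (z / 2 * Real.exp t) * (z / 2 * Real.exp t) ^ (α - 1)
        = (z / 2) ^ α * Real.exp (α * t) := by
      rw [Real.rpow_sub_one hpos.ne', mul_div_cancel₀ _ hpos.ne',
        Real.mul_rpow (by positivity) (Real.exp_nonneg _), ← Real.exp_mul, mul_comm t α]
    have h2 : Real.exp (-(z / 2 * Real.exp t)) *
        Real.exp (-(z ^ 2 / (4 * (z / 2 * Real.exp t)))) = Real.exp (-z * Real.cosh t) := by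
      rw [← Real.exp_add, Real.cosh_eq, Real.exp_neg t]
      congr 1
      field_simp
      ring
    rw [abs_of_pos hpos, smul_eq_mul]
    simp only [hg, hf, hF]
    rw [← h2]
    linear_combination Real.exp (-(z / 2 * Real.exp t)) *
        Real.exp (-(z ^ 2 / (4 * (z / 2 * Real.exp t)))) * h1
  have hc : (0 : ℝ) < (z / 2) ^ α := by positivity
  have hint : Integrable F := by
    have h := integrableOn_maternProfile hα z
    rw [← himg, integrableOn_image_iff_integrableOn_abs_deriv_smul MeasurableSet.univ hder hinj,
      integrableOn_univ] at h
    have h' : Integrable (fun t => (z / 2) ^ α * F t) := by rw [← hfun]; exact h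
    exact (integrable_const_mul_iff (isUnit_iff_ne_zero.mpr hc.ne') F).mp h'
  have hI : ∫ u in Set.Ioi (0 : ℝ), g u = (z / 2) ^ α * ∫ t, F t := by
    rw [← himg, integral_image_eq_integral_abs_deriv_smul MeasurableSet.univ hder hinj, hfun,
      setIntegral_univ, integral_const_mul]
  -- Folding the line at zero symmetrizes `exp (α * t)` into `2 * cosh (α * t)`.
  have hsplit : ∫ t, F t = 2 * besselK α z := by
    have hneg : ∫ t in Set.Iic (0 : ℝ), F t = ∫ t in Set.Ioi (0 : ℝ), F (-t) := by
      have := integral_comp_neg_Ioi 0 F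
      rw [this, neg_zero]
    rw [← intervalIntegral.integral_Iic_add_Ioi (b := (0 : ℝ)) hint.integrableOn
      hint.integrableOn, hneg, ← integral_add hint.comp_neg.integrableOn hint.integrableOn,
      besselK, ← integral_const_mul]
    refine integral_congr_ae (Eventually.of_forall fun t => ?_)
    simp only [hF, Real.cosh_neg, Real.cosh_eq (α * t)]
    ring_nf
  rw [maternProfile, hI, hsplit]
  have h2 : (2 : ℝ) ^ (α - 1) = 2 ^ α / 2 := by rw [Real.rpow_sub_one two_ne_zero]
  have hΓ := (Real.Gamma_pos_of_pos hα).ne'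
  rw [Real.div_rpow hz.le zero_le_two, h2]
  have : (0 : ℝ) < 2 ^ α := by positivity
  field_simp

end Matern

/-! ### Common properties of the two correlation families -/

namespace CorrFamily

/-- The correlation as a function of the scaled distance `d / γ`. -/
noncomputable def profile : CorrFamily → ℝ → ℝ
  | .powerExponential α, r => Real.exp (-r ^ α)
  | .matern α, r => maternProfile α r

theorem corr_eq_profile {c : CorrFamily} (hc : c.Admissible) {γ d : ℝ} (hγ : 0 < γ)
    (hd : 0 ≤ d) : c.corr γ d = c.profile (d / γ) := by
  cases c with
  | powerExponential α => rfl
  | matern α =>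
    have hα : 0 < α := hc
    rcases hd.eq_or_lt with rfl | hd
    · simp [corr, profile, maternProfile_zero hα]
    · simp only [corr, profile, if_neg hd.ne']
      exact maternProfile_eq_besselK hα (div_pos hd hγ)

variable {c : CorrFamily}

theorem profile_zero (hc : c.Admissible) : c.profile 0 = 1 := by
  cases c with
  | powerExponential α => simp [profile, Real.zero_rpow hc.1.ne']
  | matern α => exact maternProfile_zero hc

theorem profile_pos (hc : c.Admissible) (r : ℝ) : 0 < c.profile r := by
  cases c with
  | powerExponential α => exact Real.exp_pos _
  | matern α => exact maternProfile_pos hc r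

theorem profile_antitone (hc : c.Admissible) {r s : ℝ} (hr : 0 ≤ r) (hrs : r ≤ s) :
    c.profile s ≤ c.profile r := by
  cases c with
  | powerExponential α =>
    have := hc.1.le
    simp only [profile]
    gcongr
  | matern α => exact maternProfile_antitone hc hr hrs

theorem profile_lt_one (hc : c.Admissible) {r : ℝ} (hr : 0 < r) : c.profile r < 1 := by
  cases c with
  | powerExponential α =>
    simp only [profile]
    rw [Real.exp_lt_one_iff]
    have : 0 < r ^ α := by positivity
    linarith
  | matern α => exact maternProfile_lt_one hc hr

theorem profile_le_one (hc : c.Admissible) {r : ℝ} (hr : 0 ≤ r) : c.profile r ≤ 1 := by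
  rw [← profile_zero hc]; exact profile_antitone hc le_rfl hr

theorem tendsto_profile_atTop (hc : c.Admissible) : Tendsto c.profile atTop (𝓝 0) := by
  cases c with
  | powerExponential α =>
    exact Real.tendsto_exp_neg_atTop_nhds_zero.comp (tendsto_rpow_atTop hc.1)
  | matern α => exact tendsto_maternProfile_atTop hc

theorem corr_mem_gaussAlgebra {ι : Type*} [Fintype ι] (hc : c.Admissible) (x : ι → ℝ) {γ : ℝ}
    (hγ : 0 < γ) : (fun i j => c.corr γ |x i - x j|) ∈ gaussAlgebra x := by
  cases c with
  | powerExponential α => exact powerExponential_mem_gaussAlgebra x hc.1 hc.2 hγ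
  | matern α =>
    have hα : 0 < α := hc
    have e : (fun i j => (matern α).corr γ |x i - x j|) = (Real.Gamma α)⁻¹ •
        fun i j => ∫ u in Set.Ioi (0 : ℝ),
          ((Real.exp (-u) * u ^ (α - 1)) • gaussKernel x (1 / (4 * u * γ ^ 2))) i j := by
      ext i j
      rw [corr_eq_profile hc hγ (abs_nonneg _)]
      simp only [profile, maternProfile, Pi.smul_apply, smul_eq_mul, gaussKernel]
      congr 1
      refine setIntegral_congr_fun measurableSet_Ioi fun u hu => ?_
      have hu : (0 : ℝ) < u := hu
      simp only [div_pow, sq_abs]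
      congr 3
      field_simp
    rw [e]
    refine smul_mem_gaussAlgebra (integral_mem_gaussAlgebra (fun i j => ?_) ?_)
      (inv_nonneg.mpr (Real.Gamma_pos_of_pos hα).le)
    · refine (integrableOn_maternProfile hα (|x i - x j| / γ)).congr ?_
      filter_upwards [ae_restrict_mem measurableSet_Ioi] with u hu
      have hu : (0 : ℝ) < u := hu
      simp only [Pi.smul_apply, smul_eq_mul, gaussKernel, div_pow, sq_abs]
      congr 3
      field_simp
    · filter_upwards [ae_restrict_mem measurableSet_Ioi] with u hu
      have hu : (0 : ℝ) < u := hu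
      exact smul_mem_gaussAlgebra (gaussKernel_mem_gaussAlgebra x (by positivity))
        (by positivity)

end CorrFamily

/-! ### Products over the coordinates -/

/-- With `M'` and `N'` the framing sums of squares, the Schur product theorem exchanges one factor
at a time: `M' * N' ≤ M' * N ≤ M * N ≤ K • (M' * N) ≤ (K * K') • (M' * N')` as quadratic forms. -/
theorem IsFramed.mul {ι κ κ' : Type*} [Fintype ι] [Fintype κ] [Fintype κ'] {w : κ → ι → ℝ}
    {w' : κ' → ι → ℝ} {K K' : ℝ} {M N : ι → ι → ℝ} (hK : 0 ≤ K) (hM : IsFramed w K M)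
    (hN : IsFramed w' K' N) :
    IsFramed (fun (k : κ × κ') i => w k.1 i * w' k.2 i) (K * K') (M * N) := by
  obtain ⟨hMs, t, ht, hMt⟩ := hM
  obtain ⟨hNs, r, hr, hNr⟩ := hN
  refine ⟨fun i j => by simp [hMs i j, hNs i j], fun k => t k.1 * r k.2,
    fun k => mul_nonneg (ht _) (hr _), fun a => ?_⟩
  set M' : ι → ι → ℝ := fun i j => ∑ k, t k * (w k i * w k j) with hM'
  set N' : ι → ι → ℝ := fun i j => ∑ k, r k * (w' k i * w' k j) with hN'
  have hM's : ∀ i j, M' i j = M' j i := fun i j => by simp only [hM', mul_comm (w _ i)]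
  have hN's : ∀ i j, N' i j = N' j i := fun i j => by simp only [hN', mul_comm (w' _ i)]
  have hqM : ∀ a, quadForm M' a = ∑ k, t k * (w k ⬝ᵥ a) ^ 2 := quadForm_sum_sq t w
  have hqN : ∀ a, quadForm N' a = ∑ k, r k * (w' k ⬝ᵥ a) ^ 2 := quadForm_sum_sq r w'
  have hM0 : ∀ a, 0 ≤ quadForm M' a := fun a => by
    rw [hqM]; exact Finset.sum_nonneg fun k _ => mul_nonneg (ht k) (sq_nonneg _)
  have hN0 : ∀ a, 0 ≤ quadForm N' a := fun a => by
    rw [hqN]; exact Finset.sum_nonneg fun k _ => mul_nonneg (hr k) (sq_nonneg _)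
  have hq : ∑ k : κ × κ', t k.1 * r k.2 * ((fun i => w k.1 i * w' k.2 i) ⬝ᵥ a) ^ 2
      = quadForm (M' * N') a := by
    rw [← quadForm_sum_sq]
    congr 1
    ext i j
    simp only [hM', hN', Pi.mul_apply, Finset.sum_mul_sum, Fintype.sum_prod_type]
    exact Finset.sum_congr rfl fun k _ => Finset.sum_congr rfl fun l _ => by ring
  simp only [← hqM, ← hqN] at hMt hNr
  rw [hq]
  have hNN : ∀ a, 0 ≤ quadForm N a := fun a => (hN0 a).trans (hNr a).1
  constructor
  · have h1 := quadForm_mul_nonneg (M := M - M') (N := N)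
      (fun i j => by simp [hMs i j, hM's i j]) hNs
      (fun a => by rw [quadForm_sub]; linarith [(hMt a).1]) hNN a
    have h2 := quadForm_mul_nonneg (M := M') (N := N - N') hM's
      (fun i j => by simp [hNs i j, hN's i j]) hM0
      (fun a => by rw [quadForm_sub]; linarith [(hNr a).1]) a
    rw [sub_mul, quadForm_sub] at h1
    rw [mul_sub, quadForm_sub] at h2
    linarith
  · have h1 := quadForm_mul_nonneg (M := K • M' - M) (N := N)
      (fun i j => by simp [hMs i j, hM's i j]) hNs
      (fun a => by rw [quadForm_sub, quadForm_smul]; linarith [(hMt a).2]) hNN a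
    have h2 := quadForm_mul_nonneg (M := M') (N := K' • N' - N) hM's
      (fun i j => by simp [hNs i j, hN's i j]) hM0
      (fun a => by rw [quadForm_sub, quadForm_smul]; linarith [(hNr a).2]) a
    rw [sub_mul, smul_mul_assoc, quadForm_sub, quadForm_smul] at h1
    rw [mul_sub, mul_smul_comm, quadForm_sub, quadForm_smul] at h2
    have := mul_nonneg hK h2
    rw [mul_assoc]
    linarith

/-- The product correlation matrices at a given design are framed by common vectors, uniformly
over all range parameters. -/
theorem exists_isFramed_corrMatrix {m p : ℕ} (c : Fin p → CorrFamily)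
    (hc : ∀ l, (c l).Admissible) (x : Fin (m + 1) → Fin p → ℝ) :
    ∃ (κ : Type) (_ : Fintype κ) (w : κ → Fin (m + 1) → ℝ) (K : ℝ), 0 < K ∧
      ∀ γ : Fin p → ℝ, (∀ l, 0 < γ l) → IsFramed w K (corrMatrix c x γ) := by
  have key : ∀ s : Finset (Fin p), ∃ (κ : Type) (_ : Fintype κ) (w : κ → Fin (m + 1) → ℝ) (K : ℝ),
      0 < K ∧ ∀ γ : Fin p → ℝ, (∀ l, 0 < γ l) →
        IsFramed w K (∏ l ∈ s, fun i j => (c l).corr (γ l) |x i l - x j l|) := fun s => by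
    induction s using Finset.cons_induction with
    | empty =>
      refine ⟨Unit, inferInstance, fun _ _ => 1, 1, one_pos, fun γ _ => ?_⟩
      rw [Finset.prod_empty]
      refine ⟨fun i j => rfl, fun _ => 1, fun _ => zero_le_one, fun a => ?_⟩
      have := quadForm_sum_sq (fun _ : Unit => (1 : ℝ)) (fun _ (_ : Fin (m + 1)) => (1 : ℝ)) a
      simp only [Finset.univ_unique, Finset.sum_singleton, one_mul] at this ⊢
      rw [← this]
      exact ⟨le_rfl, le_rfl⟩
    | cons l s hl ih =>
      obtain ⟨κ, _, w, K, hK, h⟩ := ih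
      obtain ⟨K', hK', h'⟩ := exists_isFramed_gaussKernel fun i => x i l
      refine ⟨(Fin (m + 1) ⊕ Fin (m + 1)) × κ, inferInstance,
        fun k i => gaussFrame (fun i => x i l) k.1 i * w k.2 i, K' * K, mul_pos hK' hK, fun γ hγ => ?_⟩
      rw [Finset.prod_cons]
      exact IsFramed.mul hK'.le
        (IsFramed.of_mem_gaussAlgebra h' (CorrFamily.corr_mem_gaussAlgebra (hc l) _ (hγ l))) (h γ hγ)
  obtain ⟨κ, hκ, w, K, hK, h⟩ := key Finset.univ
  refine ⟨κ, hκ, w, K, hK, fun γ hγ => ?_⟩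
  have e : corrMatrix c x γ = ∏ l, fun i j => (c l).corr (γ l) |x i l - x j l| := by
    ext i j
    simp [corrMatrix, Finset.prod_apply]
  rw [e]
  exact h γ hγ

/-! ### Greedy bases and diagonal comparison -/

/-- Greedy selection: a linearly independent subfamily such that every vector of the family is
a combination of selected vectors of at least the same weight. -/
theorem exists_greedy_linearIndepOn {κ V : Type*} [AddCommGroup V] [Module ℝ V]
    (v : κ → V) (t : κ → ℝ) (s : Finset κ) :
    ∃ S ⊆ s, LinearIndepOn ℝ v (S : Set κ) ∧
      ∀ k ∈ s, v k ∈ Submodule.span ℝ (v '' {j | j ∈ S ∧ t k ≤ t j}) := by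
  classical
  -- Vectors arrive by decreasing weight, so all vectors selected earlier weigh at least as much as
  -- the new one.
  induction s using Finset.induction_on_min_value t with
  | empty => exact ⟨∅, by simp, by simp, by simp⟩
  | insert a s ha hmin ih =>
    obtain ⟨S, hSs, hS, hspan⟩ := ih
    have hall : {j | j ∈ S ∧ t a ≤ t j} = (S : Set κ) := by
      ext j; simp only [Set.mem_ofPred_eq, Finset.mem_coe, and_iff_left_iff_imp]
      exact fun hj => hmin j (hSs hj)
    by_cases hva : v a ∈ Submodule.span ℝ (v '' (S : Set κ))
    · refine ⟨S, hSs.trans (Finset.subset_insert _ _), hS, fun k hk => ?_⟩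
      rcases Finset.mem_insert.mp hk with rfl | hk
      · rw [hall]; exact hva
      · exact hspan k hk
    · refine ⟨insert a S, Finset.insert_subset_insert _ hSs, ?_, fun k hk => ?_⟩
      · rw [Finset.coe_insert]
        exact (linearIndepOn_insert (fun h => ha (hSs h))).mpr ⟨hS, hva⟩
      · rcases Finset.mem_insert.mp hk with rfl | hk
        · exact Submodule.subset_span ⟨k, ⟨Finset.mem_insert_self _ _, le_rfl⟩, rfl⟩
        · refine Submodule.span_mono (Set.image_mono fun j hj => ?_) (hspan k hk)
          exact ⟨Finset.mem_insert_of_mem hj.1, hj.2⟩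

/-- Greedy selection of a basis among the members of weight satisfying `s`, in matrix form:
the coordinates of every member vanish on basis vectors of smaller weight. -/
theorem exists_greedy_basis {κ : Type*} {d : ℕ} (v : κ → Fin d → ℝ) (t : κ → ℝ)
    (s : Finset κ) (hs : ∀ a : Fin d → ℝ, (∀ k ∈ s, v k ⬝ᵥ a = 0) → a = 0) :
    ∃ σ : Fin d → κ, Function.Injective σ ∧ (∀ i, σ i ∈ s) ∧
      (Matrix.of fun i => v (σ i)).det ≠ 0 ∧
      ∀ k ∈ s, ∀ i, (v k ᵥ* (Matrix.of fun i => v (σ i))⁻¹) i ≠ 0 → t k ≤ t (σ i) := by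
  classical
  obtain ⟨S, hSs, hS, hspan⟩ := exists_greedy_linearIndepOn v t s
  have htop : Submodule.span ℝ (v '' (S : Set κ)) = ⊤ := by
    by_contra hne
    obtain ⟨f, hf0, hf⟩ := Submodule.exists_le_ker_of_lt_top _ (lt_top_iff_ne_top.mpr hne)
    have hfa : ∀ b, f b = b ⬝ᵥ fun i => f (Pi.single i 1) := fun b => by
      have := LinearMap.pi_apply_eq_sum_univ f b
      rw [this]
      simp only [dotProduct, smul_eq_mul]
      refine Finset.sum_congr rfl fun i _ => ?_
      congr 2; ext j; simp [Pi.single_apply, eq_comm]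
    refine hf0 ?_
    have h0 := hs (fun i => f (Pi.single i 1)) fun k hk => by
      rw [← hfa]
      refine hf (Submodule.span_mono ?_ (hspan k hk))
      exact Set.image_mono fun j hj => hj.1
    ext i
    have := congrFun h0 i
    simpa using this
  have hli : LinearIndependent ℝ fun j : S => v j := hS
  have hcard : Fintype.card S = d := by
    have hspan' : ⊤ ≤ Submodule.span ℝ (Set.range fun j : S => v j) := by
      rw [← htop]
      refine Submodule.span_mono ?_
      rintro _ ⟨j, hj, rfl⟩
      exact ⟨⟨j, hj⟩, rfl⟩
    have := Module.finrank_eq_card_basis (Module.Basis.mk hli hspan')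
    simpa using this.symm
  let e : Fin d ≃ S := (Fintype.equivFinOfCardEq hcard).symm
  have hdet : (Matrix.of fun i => v (e i)).det ≠ 0 := by
    have h := hli.comp e e.injective
    have h2 := (Matrix.linearIndependent_rows_iff_isUnit (A := Matrix.of fun i => v (e i))).mp h
    exact ((Matrix.isUnit_iff_isUnit_det _).mp h2).ne_zero
  refine ⟨fun i => e i, fun i j h => e.injective (Subtype.ext h), fun i => hSs (e i).2, hdet,
    fun k hk i hi => ?_⟩
  by_contra! hlt
  refine hi ?_
  have hmem := hspan k hk
  have hle : Submodule.span ℝ (v '' {j | j ∈ S ∧ t k ≤ t j}) ≤ LinearMap.ker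
      ((LinearMap.proj i : (Fin d → ℝ) →ₗ[ℝ] ℝ) ∘ₗ
        (Matrix.vecMulLinear (Matrix.of fun i => v (e i))⁻¹)) := by
    rw [Submodule.span_le]
    rintro _ ⟨j, ⟨hj, hkj⟩, rfl⟩
    obtain ⟨i', hi'⟩ := e.surjective ⟨j, hj⟩
    have hij : i' ≠ i := by
      rintro rfl
      rw [hi'] at hlt
      exact absurd hkj (not_le.mpr hlt)
    have hv : v j = Pi.single i' 1 ᵥ* (Matrix.of fun i => v (e i)) := by
      rw [Matrix.single_one_vecMul]; ext l; simp [hi']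
    simp only [SetLike.mem_coe, LinearMap.mem_ker, LinearMap.comp_apply, LinearMap.proj_apply,
      Matrix.vecMulLinear_apply]
    rw [hv, Matrix.vecMul_vecMul, Matrix.mul_nonsing_inv _ (isUnit_iff_ne_zero.mpr hdet),
      Matrix.vecMul_one, Pi.single_apply, if_neg (Ne.symm hij)]
  exact hle hmem

/-- A nonsingular framed kernel is comparable to a positive diagonal form in the coordinates given
by some of the framing vectors, with a constant that does not depend on the kernel. -/
theorem exists_diagonal_comparison {κ : Type*} [Fintype κ] {d : ℕ} (w : κ → Fin d → ℝ) {K : ℝ}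
    (hK : 0 < K) :
    ∃ D : ℝ, 0 < D ∧ ∀ R : Matrix (Fin d) (Fin d) ℝ, IsFramed w K (fun i j => R i j) → R.det ≠ 0 →
      ∃ σ : Fin d → κ, (Matrix.of fun i => w (σ i)).det ≠ 0 ∧ ∃ t : Fin d → ℝ, (∀ i, 0 < t i) ∧
        ∀ a, ∑ i, t i * ((Matrix.of fun i => w (σ i)) *ᵥ a) i ^ 2 ≤ a ⬝ᵥ (R *ᵥ a) ∧
          a ⬝ᵥ (R *ᵥ a) ≤ D * ∑ i, t i * ((Matrix.of fun i => w (σ i)) *ᵥ a) i ^ 2 := by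
  classical
  -- Summing over all possible selections `σ` makes the constant independent of the selection that a
  -- particular kernel leads to.
  refine ⟨K * (1 + ∑ σ : Fin d → κ, ∑ k, ∑ i,
    (w k ᵥ* (Matrix.of fun i => w (σ i))⁻¹) i ^ 2), by positivity, fun R hR hdet => ?_⟩
  obtain ⟨hRs, t, ht, hRq⟩ := hR
  have hRt : ∀ a, ∑ k, t k * (w k ⬝ᵥ a) ^ 2 ≤ a ⬝ᵥ (R *ᵥ a) ∧
      a ⬝ᵥ (R *ᵥ a) ≤ K * ∑ k, t k * (w k ⬝ᵥ a) ^ 2 := fun a =>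
    ⟨(hRq a).1.trans_eq (quadForm_eq_dotProduct _ a),
      (quadForm_eq_dotProduct _ a).symm.trans_le (hRq a).2⟩
  have hR0 : ∀ a, 0 ≤ a ⬝ᵥ (R *ᵥ a) := fun a =>
    (Finset.sum_nonneg fun k _ => mul_nonneg (ht k) (sq_nonneg _)).trans (hRt a).1
  have hpsd : R.PosSemidef := by
    refine Matrix.PosSemidef.of_dotProduct_mulVec_nonneg ?_ fun a => ?_
    · ext i j; simp [hRs j i]
    · rw [star_trivial]; exact hR0 a
  -- The vectors of positive weight span: a vector orthogonal to all of them annihilates the form of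
  -- `R`, hence lies in its kernel, which is zero.
  obtain ⟨σ, hσ, hσs, hσd, hσw⟩ := exists_greedy_basis w t (Finset.univ.filter fun k => 0 < t k)
    fun a ha => by
      have h0 : ∑ k, t k * (w k ⬝ᵥ a) ^ 2 = 0 := Finset.sum_eq_zero fun k _ => by
        rcases (ht k).eq_or_lt with h | h
        · rw [← h, zero_mul]
        · rw [ha k (by simp [h])]; simp
      have h1 : a ⬝ᵥ (R *ᵥ a) = 0 := le_antisymm (by simpa [h0] using (hRt a).2) (hR0 a)
      have h2 : R *ᵥ a = 0 := (hpsd.dotProduct_mulVec_zero_iff a).mp (by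
        rw [star_trivial]; exact h1)
      exact Matrix.eq_zero_of_mulVec_eq_zero hdet h2
  refine ⟨σ, hσd, fun i => t (σ i), fun i => by simpa using hσs i, fun a => ⟨?_, ?_⟩⟩
  · refine le_trans ?_ (hRt a).1
    have : ∑ i, t (σ i) * ((Matrix.of fun i => w (σ i)) *ᵥ a) i ^ 2
        = ∑ k ∈ Finset.univ.image σ, t k * (w k ⬝ᵥ a) ^ 2 := by
      rw [Finset.sum_image fun i _ j _ h => hσ h]; rfl
    rw [this]
    exact Finset.sum_le_univ_sum_of_nonneg fun k => mul_nonneg (ht k) (sq_nonneg _)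
  · set W : Matrix (Fin d) (Fin d) ℝ := Matrix.of fun i => w (σ i) with hW
    set T := ∑ i, t (σ i) * (W *ᵥ a) i ^ 2 with hT
    have hT0 : 0 ≤ T := Finset.sum_nonneg fun i _ => mul_nonneg (ht _) (sq_nonneg _)
    have hk : ∀ k, t k * (w k ⬝ᵥ a) ^ 2 ≤ (∑ i, (w k ᵥ* W⁻¹) i ^ 2) * T := fun k => by
      rcases (ht k).eq_or_lt with h | h
      · rw [← h, zero_mul]; positivity
      set b := w k ᵥ* W⁻¹ with hb
      -- Masking the coordinates where `b` vanishes matters: `t k ≤ t (σ i)` is known only where `b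
      -- i ≠ 0`.
      have hwk : w k ⬝ᵥ a = ∑ i, b i * (if b i = 0 then 0 else (W *ᵥ a) i) := by
        have : w k = b ᵥ* W := by
          rw [hb, Matrix.vecMul_vecMul, Matrix.nonsing_inv_mul _ (isUnit_iff_ne_zero.mpr hσd),
            Matrix.vecMul_one]
        rw [this, ← Matrix.dotProduct_mulVec, dotProduct]
        refine Finset.sum_congr rfl fun i _ => ?_
        by_cases h : b i = 0 <;> simp [h]
      calc t k * (w k ⬝ᵥ a) ^ 2
          ≤ t k * ((∑ i, b i ^ 2) * ∑ i, (if b i = 0 then 0 else (W *ᵥ a) i) ^ 2) := by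
            rw [hwk]
            gcongr
            exact Finset.sum_mul_sq_le_sq_mul_sq _ _ _
        _ = (∑ i, b i ^ 2) * ∑ i, t k * (if b i = 0 then 0 else (W *ᵥ a) i) ^ 2 := by
            rw [mul_left_comm, Finset.mul_sum]
        _ ≤ _ := by
            refine mul_le_mul_of_nonneg_left (Finset.sum_le_sum fun i _ => ?_) (by positivity)
            split_ifs with h0
            · simp; exact mul_nonneg (ht _) (sq_nonneg _)
            · gcongr
              exact hσw k (by simp [h]) i h0
    calc a ⬝ᵥ (R *ᵥ a) ≤ K * ∑ k, t k * (w k ⬝ᵥ a) ^ 2 := (hRt a).2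
      _ ≤ K * ∑ k, (∑ i, (w k ᵥ* W⁻¹) i ^ 2) * T := 
          mul_le_mul_of_nonneg_left (Finset.sum_le_sum fun k _ => hk k) hK.le
      _ = K * (∑ k, ∑ i, (w k ᵥ* W⁻¹) i ^ 2) * T := by rw [← Finset.sum_mul, mul_assoc]
      _ ≤ _ := by
        gcongr
        have := Finset.single_le_sum (f := fun σ : Fin d → κ => ∑ k, ∑ i,
          (w k ᵥ* (Matrix.of fun i => w (σ i))⁻¹) i ^ 2) (fun σ _ => by positivity)
          (Finset.mem_univ σ)
        linarith

theorem one_le_det_of_quadForm {d : ℕ} {A : Matrix (Fin d) (Fin d) ℝ} (hA : A.IsHermitian)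
    (h : ∀ a, ∑ i, a i ^ 2 ≤ a ⬝ᵥ (A *ᵥ a)) : 1 ≤ A.det := by
  rw [hA.det_eq_prod_eigenvalues]
  refine Finset.prod_induction _ (fun r : ℝ => 1 ≤ r) (fun _ _ => one_le_mul_of_one_le_of_one_le)
    le_rfl fun i _ => ?_
  have h1 := h (hA.eigenvectorBasis i)
  have h2 := hA.eigenvalues_eq i
  have h3 : ∑ j, hA.eigenvectorBasis i j ^ 2 = 1 := by
    have := hA.eigenvectorBasis.orthonormal.1 i
    rw [EuclideanSpace.norm_eq, Real.sqrt_eq_one] at this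
    simpa using this
  simp only [star_trivial, RCLike.re_to_real] at h2
  rw [h3, ← h2] at h1
  exact h1

/-! ### Determinant, inverse and normal density under a diagonal comparison -/

section DensityBound

variable {d : ℕ} {W R : Matrix (Fin d) (Fin d) ℝ} {t : Fin d → ℝ} {D : ℝ}

/-- A congruence that takes the diagonal form to the identity leaves a matrix with all eigenvalues
at least `1`. -/
theorem det_ge_of_diagonal_comparison (hRs : R.IsHermitian) (hW : W.det ≠ 0) (ht : ∀ i, 0 < t i)
    (h : ∀ a, ∑ i, t i * (W *ᵥ a) i ^ 2 ≤ a ⬝ᵥ (R *ᵥ a)) :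
    W.det ^ 2 * ∏ i, t i ≤ R.det := by
  set C : Matrix (Fin d) (Fin d) ℝ := Matrix.diagonal (fun i => Real.sqrt (t i)) * W with hC
  have hCd : C.det ^ 2 = W.det ^ 2 * ∏ i, t i := by
    rw [hC, Matrix.det_mul, Matrix.det_diagonal, mul_pow, ← Finset.prod_pow, mul_comm]
    congr 1
    exact Finset.prod_congr rfl fun i _ => Real.sq_sqrt (ht i).le
  have hpos : 0 < C.det ^ 2 := by
    rw [hCd]; exact mul_pos (by positivity) (Finset.prod_pos fun i _ => ht i)
  have hCu : IsUnit C.det := isUnit_iff_ne_zero.mpr fun h0 => by rw [h0] at hpos; simp at hpos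
  have h1 : 1 ≤ (C⁻¹ᵀ * R * C⁻¹).det := by
    refine one_le_det_of_quadForm ?_ fun a => ?_
    · have := Matrix.isHermitian_conjTranspose_mul_mul C⁻¹ hRs
      simpa using this
    · have e : a ⬝ᵥ ((C⁻¹ᵀ * R * C⁻¹) *ᵥ a) = (C⁻¹ *ᵥ a) ⬝ᵥ (R *ᵥ (C⁻¹ *ᵥ a)) := by
        rw [← Matrix.mulVec_mulVec, ← Matrix.mulVec_mulVec, Matrix.dotProduct_mulVec,
          Matrix.vecMul_transpose]
      rw [e]
      refine le_trans (le_of_eq ?_) (h _)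
      refine Finset.sum_congr rfl fun i _ => ?_
      have h2 : (C *ᵥ (C⁻¹ *ᵥ a)) i = a i := by
        rw [Matrix.mulVec_mulVec, Matrix.mul_nonsing_inv _ hCu, Matrix.one_mulVec]
      have h3 : (C *ᵥ (C⁻¹ *ᵥ a)) i = Real.sqrt (t i) * (W *ᵥ (C⁻¹ *ᵥ a)) i := by
        rw [hC, ← Matrix.mulVec_mulVec, Matrix.mulVec_diagonal]
      rw [← h2, h3, mul_pow, Real.sq_sqrt (ht i).le]
  rw [Matrix.det_mul, Matrix.det_mul, Matrix.det_transpose] at h1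
  have h4 : C⁻¹.det * C.det = 1 := by
    rw [← Matrix.det_mul, Matrix.nonsing_inv_mul _ hCu, Matrix.det_one]
  calc W.det ^ 2 * ∏ i, t i = C.det ^ 2 * 1 := by rw [hCd, mul_one]
    _ ≤ C.det ^ 2 * (C⁻¹.det * R.det * C⁻¹.det) := by gcongr
    _ = (C⁻¹.det * C.det) ^ 2 * R.det := by ring
    _ = R.det := by rw [h4]; ring

/-- The inverse form is the maximum over `a` of `2 * (z ⬝ᵥ a) - a ⬝ᵥ (R *ᵥ a)`. The test vector is
the maximizer for the diagonal upper bound of `R`. -/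
theorem inv_quadForm_ge_of_diagonal_comparison (hRs : R.IsHermitian) (hR : R.det ≠ 0)
    (hW : W.det ≠ 0) (ht : ∀ i, 0 < t i) (hD : 0 < D)
    (h : ∀ a, ∑ i, t i * (W *ᵥ a) i ^ 2 ≤ a ⬝ᵥ (R *ᵥ a) ∧
      a ⬝ᵥ (R *ᵥ a) ≤ D * ∑ i, t i * (W *ᵥ a) i ^ 2) (z : Fin d → ℝ) :
    (∑ i, (z ᵥ* W⁻¹) i ^ 2 / t i) / D ≤ z ⬝ᵥ (R⁻¹ *ᵥ z) := by
  have hRu : IsUnit R.det := isUnit_iff_ne_zero.mpr hR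
  have hWu : IsUnit W.det := isUnit_iff_ne_zero.mpr hW
  have hRT : Rᵀ = R := by rw [← Matrix.conjTranspose_eq_transpose_of_trivial]; exact hRs
  set S := ∑ i, (z ᵥ* W⁻¹) i ^ 2 / t i with hS
  set u : Fin d → ℝ := fun i => (z ᵥ* W⁻¹) i / t i with hu
  set a : Fin d → ℝ := D⁻¹ • (W⁻¹ *ᵥ u) with ha
  have h1 : z ⬝ᵥ a = S / D := by
    rw [ha, dotProduct_smul, Matrix.dotProduct_mulVec, dotProduct, smul_eq_mul, hS,
      div_eq_inv_mul]
    congr 1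
    exact Finset.sum_congr rfl fun i _ => by simp only [hu]; ring
  have h2 : a ⬝ᵥ (R *ᵥ a) ≤ S / D := by
    refine (h a).2.trans (le_of_eq ?_)
    have : W *ᵥ a = D⁻¹ • u := by
      rw [ha, Matrix.mulVec_smul, Matrix.mulVec_mulVec, Matrix.mul_nonsing_inv _ hWu,
        Matrix.one_mulVec]
    rw [this, hS, Finset.mul_sum, Finset.sum_div]
    refine Finset.sum_congr rfl fun i _ => ?_
    have := (ht i).ne'
    simp only [Pi.smul_apply, smul_eq_mul, hu]
    field_simp
  have h3 : 0 ≤ (R⁻¹ *ᵥ z - a) ⬝ᵥ (R *ᵥ (R⁻¹ *ᵥ z - a)) :=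
    (Finset.sum_nonneg fun i _ => mul_nonneg (ht i).le (sq_nonneg _)).trans (h _).1
  have h4 : R *ᵥ (R⁻¹ *ᵥ z) = z := by
    rw [Matrix.mulVec_mulVec, Matrix.mul_nonsing_inv _ hRu, Matrix.one_mulVec]
  have h5 : (R⁻¹ *ᵥ z) ⬝ᵥ (R *ᵥ a) = z ⬝ᵥ a := by
    rw [Matrix.dotProduct_mulVec, ← Matrix.mulVec_transpose, hRT, h4]
  rw [Matrix.mulVec_sub, h4, sub_dotProduct, dotProduct_sub, dotProduct_sub, h5,
    dotProduct_comm (R⁻¹ *ᵥ z) z, dotProduct_comm a z] at h3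
  linarith

theorem normalDensity_le_of_diagonal_comparison (hRs : R.IsHermitian) (hW : W.det ≠ 0)
    (ht : ∀ i, 0 < t i) (hD : 0 < D)
    (h : ∀ a, ∑ i, t i * (W *ᵥ a) i ^ 2 ≤ a ⬝ᵥ (R *ᵥ a) ∧
      a ⬝ᵥ (R *ᵥ a) ≤ D * ∑ i, t i * (W *ᵥ a) i ^ 2) {v : ℝ} (hv : 0 < v) (μ y : Fin d → ℝ) :
    normalDensity μ v R y ≤ (Real.sqrt ((2 * Real.pi * v) ^ d * (W.det ^ 2 * ∏ i, t i)))⁻¹ *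
      Real.exp (-((∑ i, ((y - μ) ᵥ* W⁻¹) i ^ 2 / t i) / (2 * D * v))) := by
  have hdet := det_ge_of_diagonal_comparison hRs hW ht fun a => (h a).1
  have hpos : 0 < W.det ^ 2 * ∏ i, t i :=
    mul_pos (by positivity) (Finset.prod_pos fun i _ => ht i)
  have hq := inv_quadForm_ge_of_diagonal_comparison hRs (hpos.trans_le hdet).ne' hW ht hD h (y - μ)
  unfold normalDensity
  have hvp : 0 < (2 * Real.pi * v) ^ d := by positivity
  gcongr
  · rw [neg_div]
    refine neg_le_neg ?_
    rw [le_div_iff₀ (by positivity)]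
    refine le_trans (le_of_eq ?_) hq
    field_simp

end DensityBound

/-! ### Integrals over the mean parameter and the variance -/

section Integrals

theorem lintegral_exp_neg_sum_sq_ne_top (q : ℕ) :
    ∫⁻ ξ : Fin q → ℝ, ENNReal.ofReal (Real.exp (-∑ k, ξ k ^ 2)) ≠ ⊤ := by
  have h1 : Integrable fun x : ℝ => Real.exp (-x ^ 2) := by
    simpa using integrable_exp_neg_mul_sq one_pos
  have h : Integrable fun ξ : Fin q → ℝ => Real.exp (-∑ k, ξ k ^ 2) := by
    have := Integrable.fintype_prod (f := fun (_ : Fin q) (x : ℝ) => Real.exp (-x ^ 2))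
      (μ := fun _ => volume) fun _ => h1
    refine this.congr (Eventually.of_forall fun ξ => ?_)
    simp only [← Real.exp_sum, Finset.sum_neg_distrib]
  exact h.lintegral_lt_top.ne

theorem lintegral_exp_neg_sum_sq_comp {q : ℕ} {M : Matrix (Fin q) (Fin q) ℝ} (hM : M.det ≠ 0)
    (b : Fin q → ℝ) :
    ∫⁻ θ : Fin q → ℝ, ENNReal.ofReal (Real.exp (-∑ k, (b k - (M *ᵥ θ) k) ^ 2)) =
      ENNReal.ofReal |M.det⁻¹| *
        ∫⁻ ξ : Fin q → ℝ, ENNReal.ofReal (Real.exp (-∑ k, ξ k ^ 2)) := by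
  set f : (Fin q → ℝ) → ℝ≥0∞ := fun ξ => ENNReal.ofReal (Real.exp (-∑ k, ξ k ^ 2)) with hf
  have hfm : Measurable f := by
    refine ENNReal.measurable_ofReal.comp (Continuous.measurable ?_); fun_prop
  have hM' : Measurable (Matrix.toLin' M) :=
    (LinearMap.continuous_of_finiteDimensional _).measurable
  calc _ = ∫⁻ θ, f (b - Matrix.toLin' M θ) := by simp [hf, Matrix.toLin'_apply]
    _ = ∫⁻ ξ, f (b - ξ) ∂(Measure.map (Matrix.toLin' M) volume) := by
      rw [lintegral_map (f := fun ξ => f (b - ξ))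
        (hfm.comp (measurable_const.sub measurable_id)) hM']
    _ = ENNReal.ofReal |M.det⁻¹| * ∫⁻ ξ, f (b - ξ) := by
      rw [Real.map_matrix_volume_pi_eq_smul_volume_pi hM, lintegral_smul_measure, smul_eq_mul]
    _ = _ := by rw [lintegral_sub_left_eq_self f b]

/-- Only the homogeneity in `ρ` matters. Below `v = ρ` the exponential beats the power, giving the
term `N !`; above it the exponential is at most `1`, giving `1 / κ`. -/
theorem exists_lintegral_rpow_mul_exp_le {κ : ℝ} (hκ : 0 < κ) :
    ∃ C : ℝ, 0 < C ∧ ∀ ρ : ℝ, 0 < ρ →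
      ∫⁻ v in Set.Ioi (0 : ℝ), ENNReal.ofReal (v ^ (-κ - 1) * Real.exp (-(ρ / v)))
        ≤ ENNReal.ofReal (C * ρ ^ (-κ)) := by
  obtain ⟨N, hN⟩ := exists_nat_ge (κ + 1)
  refine ⟨N.factorial + 1 / κ, by positivity, fun ρ hρ => ?_⟩
  rw [← Set.Ioc_union_Ioi_eq_Ioi hρ.le]
  refine (lintegral_union_le _ _ _).trans ?_
  rw [add_mul, ENNReal.ofReal_add (by positivity) (by positivity)]
  refine add_le_add ?_ ?_
  · calc _ ≤ ∫⁻ v in Set.Ioc (0 : ℝ) ρ, ENNReal.ofReal (N.factorial * ρ ^ (-κ - 1)) := by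
          refine setLIntegral_mono' measurableSet_Ioc fun v hv => ENNReal.ofReal_le_ofReal ?_
          have hv0 : 0 < v := hv.1
          have hx : 1 ≤ ρ / v := (one_le_div hv0).mpr hv.2
          have h1 : (ρ / v) ^ (κ + 1) ≤ N.factorial * Real.exp (ρ / v) := by
            calc (ρ / v) ^ (κ + 1) ≤ (ρ / v) ^ (N : ℝ) := Real.rpow_le_rpow_of_exponent_le hx hN
              _ = (ρ / v) ^ N := Real.rpow_natCast _ _
              _ ≤ _ := by
                have := Real.pow_div_factorial_le_exp (ρ / v) (by positivity) N
                rwa [div_le_iff₀ (by positivity), mul_comm] at this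
          have h2 : v ^ (-κ - 1) = ρ ^ (-κ - 1) * (ρ / v) ^ (κ + 1) := by
            rw [Real.div_rpow hρ.le hv0.le, show -κ - 1 = -(κ + 1) by ring,
              Real.rpow_neg hv0.le, Real.rpow_neg hρ.le]
            field_simp
          have h3 : Real.exp (ρ / v) * Real.exp (-(ρ / v)) = 1 := by
            rw [← Real.exp_add]; simp
          rw [h2]
          calc _ ≤ ρ ^ (-κ - 1) * (N.factorial * Real.exp (ρ / v)) * Real.exp (-(ρ / v)) := by
                gcongr
            _ = _ := by linear_combination ρ ^ (-κ - 1) * N.factorial * h3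
      _ = ENNReal.ofReal (N.factorial * ρ ^ (-κ - 1)) * ENNReal.ofReal ρ := by
          rw [setLIntegral_const, Real.volume_Ioc, sub_zero]
      _ ≤ _ := by
          rw [← ENNReal.ofReal_mul (by positivity), Real.rpow_sub_one hρ.ne']
          refine ENNReal.ofReal_le_ofReal (le_of_eq ?_)
          field_simp
  · calc _ ≤ ∫⁻ v in Set.Ioi ρ, ENNReal.ofReal (v ^ (-κ - 1)) := by
          refine setLIntegral_mono' measurableSet_Ioi fun v hv => ENNReal.ofReal_le_ofReal ?_
          have hv : 0 < v := hρ.trans hv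
          refine mul_le_of_le_one_right (by positivity) ?_
          rw [Real.exp_le_one_iff]
          have : 0 < ρ / v := by positivity
          linarith
      _ = ENNReal.ofReal (∫ v in Set.Ioi ρ, v ^ (-κ - 1)) := by
          rw [ofReal_integral_eq_lintegral_ofReal
            (integrableOn_Ioi_rpow_of_lt (by linarith) hρ)]
          filter_upwards [ae_restrict_mem measurableSet_Ioi] with v hv
          have hv : 0 < v := hρ.trans hv
          simp only [Pi.zero_apply]; positivity
      _ ≤ _ := by
          rw [integral_Ioi_rpow_of_lt (by linarith) hρ]
          refine ENNReal.ofReal_le_ofReal (le_of_eq ?_)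
          rw [sub_add_cancel, neg_div_neg_eq]; ring

end Integrals

/-! ### Boundedness of the marginal likelihood -/

/-- The residual of row `j` after elimination of the rows `τ k` is controlled by the weighted
sum of squares. -/
theorem sum_sq_div_ge_residual {n q : ℕ} {t : Fin n → ℝ} (ht : ∀ i, 0 < t i)
    {τ : Fin q → Fin n} (hτ : Function.Injective τ) {j : Fin n} (hj : ∀ k, τ k ≠ j)
    {b : Fin q → ℝ} (hb : ∀ k, b k ≠ 0 → t (τ k) ≤ t j) (e : Fin n → ℝ) :
    (∑ k, e (τ k) ^ 2 / t (τ k) + (e j - ∑ k, b k * e (τ k)) ^ 2 / t j) / (3 + 2 * ∑ k, b k ^ 2)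
      ≤ ∑ i, e i ^ 2 / t i := by
  classical
  set A := ∑ k, e (τ k) ^ 2 / t (τ k) with hA
  set B := ∑ k, b k ^ 2 with hB
  have hB0 : 0 ≤ B := by positivity
  have hA0 : 0 ≤ A := Finset.sum_nonneg fun k _ => div_nonneg (sq_nonneg _) (ht _).le
  have hjp := ht j
  have h1 : A + e j ^ 2 / t j ≤ ∑ i, e i ^ 2 / t i := by
    have hn : j ∉ Finset.univ.image τ := by simpa using hj
    have : A + e j ^ 2 / t j = ∑ i ∈ insert j (Finset.univ.image τ), e i ^ 2 / t i := by
      rw [Finset.sum_insert hn, Finset.sum_image fun _ _ _ _ h => hτ h, add_comm]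
    rw [this]
    exact Finset.sum_le_univ_sum_of_nonneg fun i => div_nonneg (sq_nonneg _) (ht _).le
  have h2 : (∑ k, b k * e (τ k)) ^ 2 / t j ≤ B * A := by
    have e1 : ∑ k, b k * e (τ k) = ∑ k, b k * (if b k = 0 then 0 else e (τ k)) :=
      Finset.sum_congr rfl fun k _ => by by_cases h : b k = 0 <;> simp [h]
    rw [e1, div_le_iff₀ hjp]
    refine (Finset.sum_mul_sq_le_sq_mul_sq _ _ _).trans ?_
    rw [mul_assoc]
    refine mul_le_mul_of_nonneg_left ?_ hB0
    rw [hA, Finset.sum_mul]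
    refine Finset.sum_le_sum fun k _ => ?_
    have hk := ht (τ k)
    split_ifs with h
    · rw [zero_pow two_ne_zero]; positivity
    · rw [div_mul_eq_mul_div, le_div_iff₀ hk]
      exact mul_le_mul_of_nonneg_left (hb k h) (sq_nonneg _)
  have h3 : (e j - ∑ k, b k * e (τ k)) ^ 2 / t j
      ≤ 2 * (e j ^ 2 / t j) + 2 * ((∑ k, b k * e (τ k)) ^ 2 / t j) := by
    rw [← mul_div_assoc, ← mul_div_assoc, ← add_div]
    gcongr
    nlinarith [sq_nonneg (e j + ∑ k, b k * e (τ k))]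
  -- With `E = e j ^ 2 / t j`, the left side is at most `A + 2 * E + 2 * B * A`, which `(3 + 2 * B)
  -- * (A + E)` dominates.
  rw [div_le_iff₀ (by positivity)]
  have h4 : 0 ≤ e j ^ 2 / t j := by positivity
  have h5 : (A + e j ^ 2 / t j) * (3 + 2 * B) ≤ (∑ i, e i ^ 2 / t i) * (3 + 2 * B) := by gcongr
  nlinarith [mul_nonneg hB0 h4]


/-- Bound of the marginal likelihood in diagonal coordinates that does not depend on the
weights `t`. -/
theorem exists_marginalLikelihood_le {n q : ℕ} (hq : q < n) {W : Matrix (Fin n) (Fin n) ℝ}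
    (hW : W.det ≠ 0) {D : ℝ} (hD : 0 < D) (H : Matrix (Fin n) (Fin q) ℝ) {τ : Fin q → Fin n}
    (hτ : Function.Injective τ) (hG : ((W⁻¹ᵀ * H).submatrix τ id).det ≠ 0) {j : Fin n}
    (hj : ∀ k, τ k ≠ j) (b : Fin q → ℝ) (hbG : (W⁻¹ᵀ * H) j = b ᵥ* (W⁻¹ᵀ * H).submatrix τ id)
    (y : Fin n → ℝ) (hr : (y ᵥ* W⁻¹) j - ∑ k, b k * (y ᵥ* W⁻¹) (τ k) ≠ 0) :
    ∃ L : NNReal, ∀ (R : Matrix (Fin n) (Fin n) ℝ) (t : Fin n → ℝ), R.IsHermitian →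
      (∀ i, 0 < t i) →
      (∀ a, ∑ i, t i * (W *ᵥ a) i ^ 2 ≤ a ⬝ᵥ (R *ᵥ a) ∧
        a ⬝ᵥ (R *ᵥ a) ≤ D * ∑ i, t i * (W *ᵥ a) i ^ 2) →
      (∀ k, b k ≠ 0 → t (τ k) ≤ t j) → (∀ i, (∀ k, τ k ≠ i) → t j ≤ t i) →
      marginalLikelihood H R y ≤ L := by
  classical
  set G := W⁻¹ᵀ * H with hGdef
  set z := y ᵥ* W⁻¹ with hz
  set r := z j - ∑ k, b k * z (τ k) with hrdef
  set m := n - q with hm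
  have hm0 : (0 : ℝ) < m / 2 := by
    have : 0 < m := Nat.sub_pos_of_lt hq
    positivity
  obtain ⟨C, hC, hCint⟩ := exists_lintegral_rpow_mul_exp_le hm0
  set Z := ∫⁻ ξ : Fin q → ℝ, ENNReal.ofReal (Real.exp (-∑ k, ξ k ^ 2)) with hZ
  have hZt : Z ≠ ⊤ := lintegral_exp_neg_sum_sq_ne_top q
  set a : ℝ := 1 / (2 * D * (3 + 2 * ∑ k, b k ^ 2)) with ha
  have ha0 : 0 < a := by positivity
  set C₁ : ℝ := Real.sqrt (1 / (a ^ q * (2 * Real.pi) ^ n * W.det ^ 2)) with hC₁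
  have hC₁0 : 0 ≤ C₁ := Real.sqrt_nonneg _
  set g : ℝ := |(G.submatrix τ id).det⁻¹| with hg
  have hg0 : 0 ≤ g := abs_nonneg _
  have hr2 : 0 < r ^ 2 := by positivity
  refine ⟨(ENNReal.ofReal (C₁ * g * (C * (a * r ^ 2) ^ (-((m : ℝ) / 2)))) * Z).toNNReal,
    fun R t hRs ht hRt hbt htj => ?_⟩
  rw [ENNReal.coe_toNNReal (ENNReal.mul_ne_top ENNReal.ofReal_ne_top hZt)]
  have hresid : ∀ θ, z - G *ᵥ θ = (y - H *ᵥ θ) ᵥ* W⁻¹ := fun θ => by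
    rw [sub_vecMul, hGdef, ← Matrix.mulVec_mulVec, Matrix.mulVec_transpose]
  -- lower bound of the weighted sum of squares
  have hsum : ∀ θ, a * (∑ k, (z (τ k) - (G.submatrix τ id *ᵥ θ) k) ^ 2 / t (τ k) + r ^ 2 / t j)
      ≤ (∑ i, ((y - H *ᵥ θ) ᵥ* W⁻¹) i ^ 2 / t i) / (2 * D) := fun θ => by
    have h := sum_sq_div_ge_residual ht hτ hj hbt (z - G *ᵥ θ)
    have e1 : (z - G *ᵥ θ) j - ∑ k, b k * (z - G *ᵥ θ) (τ k) = r := by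
      have : (G *ᵥ θ) j = ∑ k, b k * (G *ᵥ θ) (τ k) := by
        have h2 : (G *ᵥ θ) j = (b ᵥ* G.submatrix τ id) ⬝ᵥ θ := by rw [← hbG]; rfl
        rw [h2, ← Matrix.dotProduct_mulVec]; rfl
      simp only [Pi.sub_apply, mul_sub, Finset.sum_sub_distrib, hrdef, this]
      ring
    rw [e1, div_le_iff₀ (by positivity)] at h
    rw [← hresid, ha, one_div_mul_eq_div, div_le_div_iff₀ (by positivity) (by positivity)]
    have h' := mul_le_mul_of_nonneg_right h (by positivity : 0 ≤ 2 * D)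
    refine le_trans (le_of_eq ?_) (h'.trans (le_of_eq (by ring)))
    rfl
  have htjp := ht j
  -- comparison of the determinants
  have hprod : (∏ k, t (τ k)) * t j ^ m ≤ ∏ i, t i := by
    have hcard : (Finset.univ.image τ)ᶜ.card = m := by
      rw [Finset.card_compl, Finset.card_image_of_injective _ hτ]; simp [hm]
    rw [← Finset.prod_mul_prod_compl (Finset.univ.image τ), Finset.prod_image fun _ _ _ _ h => hτ h,
      ← hcard, ← Finset.prod_const]
    refine mul_le_mul_of_nonneg_left (Finset.prod_le_prod (fun _ _ => htjp.le) fun i hi => ?_)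
      (Finset.prod_nonneg fun k _ => (ht _).le)
    exact htj i (by simpa using hi)
  have hQ : 0 < ∏ k, t (τ k) := Finset.prod_pos fun k _ => ht _
  have hP : 0 < ∏ i, t i := Finset.prod_pos fun i _ => ht i
  -- the inner integral
  have hinner : ∀ v, 0 < v → ∫⁻ θ : Fin q → ℝ,
      ENNReal.ofReal (normalDensity (H *ᵥ θ) v R y * (1 / v)) ≤
      ENNReal.ofReal (C₁ * g * t j ^ (-((m : ℝ) / 2))) * Z *
        ENNReal.ofReal (v ^ (-((m : ℝ) / 2) - 1) * Real.exp (-(a * r ^ 2 / t j / v))) := by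
    intro v hv
    -- Rescaling the selected rows by `s` makes the exponent a standard Gaussian in the variable `M
    -- *ᵥ θ`.
    set s : Fin q → ℝ := fun k => Real.sqrt (a / (v * t (τ k))) with hs
    have hs2 : ∀ k, s k ^ 2 = a / (v * t (τ k)) := fun k =>
      Real.sq_sqrt (div_nonneg ha0.le (mul_nonneg hv.le (ht _).le))
    have hsp : ∀ k, 0 < s k := fun k => Real.sqrt_pos.mpr (div_pos ha0 (mul_pos hv (ht _)))
    set M : Matrix (Fin q) (Fin q) ℝ := Matrix.diagonal s * G.submatrix τ id with hM
    have hMdet : M.det = (∏ k, s k) * (G.submatrix τ id).det := by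
      rw [hM, Matrix.det_mul, Matrix.det_diagonal]
    have hsprod : 0 < ∏ k, s k := Finset.prod_pos fun k _ => hsp k
    have hM0 : M.det ≠ 0 := by rw [hMdet]; exact mul_ne_zero hsprod.ne' hG
    set A : ℝ := (Real.sqrt ((2 * Real.pi * v) ^ n * (W.det ^ 2 * ∏ i, t i)))⁻¹ with hA
    have hA0 : 0 ≤ A := by positivity
    have hpt : ∀ θ, normalDensity (H *ᵥ θ) v R y * (1 / v) ≤
        (A * (1 / v) * Real.exp (-(a * r ^ 2 / t j / v))) *
          Real.exp (-∑ k, (s k * z (τ k) - (M *ᵥ θ) k) ^ 2) := fun θ => by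
      have h := normalDensity_le_of_diagonal_comparison hRs hW ht hD hRt hv (H *ᵥ θ) y
      have e2 : ∑ k, (s k * z (τ k) - (M *ᵥ θ) k) ^ 2
          = a / v * ∑ k, (z (τ k) - (G.submatrix τ id *ᵥ θ) k) ^ 2 / t (τ k) := by
        rw [Finset.mul_sum]
        refine Finset.sum_congr rfl fun k _ => ?_
        rw [hM, ← Matrix.mulVec_mulVec, Matrix.mulVec_diagonal, ← mul_sub, mul_pow, hs2]
        have := (ht (τ k)).ne'
        field_simp
      have hle : Real.exp (-((∑ i, ((y - H *ᵥ θ) ᵥ* W⁻¹) i ^ 2 / t i) / (2 * D * v))) ≤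
          Real.exp (-(a * r ^ 2 / t j / v)) *
            Real.exp (-∑ k, (s k * z (τ k) - (M *ᵥ θ) k) ^ 2) := by
        rw [← Real.exp_add, Real.exp_le_exp, e2, ← div_div]
        have := div_le_div_of_nonneg_right (hsum θ) hv.le
        refine le_trans (neg_le_neg this) (le_of_eq ?_)
        field_simp
        ring
      calc _ ≤ A * Real.exp (-((∑ i, ((y - H *ᵥ θ) ᵥ* W⁻¹) i ^ 2 / t i) / (2 * D * v)))
            * (1 / v) := by gcongr
        _ ≤ A * (Real.exp (-(a * r ^ 2 / t j / v)) *
            Real.exp (-∑ k, (s k * z (τ k) - (M *ᵥ θ) k) ^ 2)) * (1 / v) := by gcongr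
        _ = _ := by ring
    -- The Jacobian of the `q` selected rows cancels their weights and `q` of the `n` powers of `v`;
    -- each of the other `m` weights is at least `t j`.
    have hscalar : A * (∏ k, s k)⁻¹ ≤ C₁ * (t j ^ (-((m : ℝ) / 2)) * v ^ (-((m : ℝ) / 2))) := by
      have hpow : ∀ u : ℝ, 0 < u → u ^ (-((m : ℝ) / 2)) = Real.sqrt (1 / u ^ m) := fun u hu => by
        rw [Real.sqrt_eq_rpow, one_div, ← Real.rpow_natCast, ← Real.rpow_neg hu.le,
          ← Real.rpow_mul hu.le]
        congr 1; ring
      have hsp' : (∏ k, s k)⁻¹ = Real.sqrt (v ^ q * (∏ k, t (τ k)) / a ^ q) := by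
        rw [hs, ← Real.sqrt_prod _ fun k _ => div_nonneg ha0.le (mul_nonneg hv.le (ht _).le),
          ← Real.sqrt_inv, Finset.prod_div_distrib, Finset.prod_mul_distrib]
        simp
      rw [hpow _ htjp, hpow _ hv, hsp', hA, ← Real.sqrt_inv, hC₁,
        ← Real.sqrt_mul (inv_nonneg.mpr (by positivity)), ← Real.sqrt_mul (by positivity),
        ← Real.sqrt_mul (by positivity)]
      refine Real.sqrt_le_sqrt ?_
      have hvn : v ^ n = v ^ q * v ^ m := by rw [← pow_add]; congr 1; omega
      have hWp : 0 < W.det ^ 2 := by positivity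
      rw [mul_pow, hvn]
      calc ((2 * Real.pi) ^ n * (v ^ q * v ^ m) * (W.det ^ 2 * ∏ i, t i))⁻¹ *
            (v ^ q * (∏ k, t (τ k)) / a ^ q)
          ≤ ((2 * Real.pi) ^ n * (v ^ q * v ^ m) * (W.det ^ 2 *
              ((∏ k, t (τ k)) * t j ^ m)))⁻¹ * (v ^ q * (∏ k, t (τ k)) / a ^ q) := by
            gcongr
        _ = _ := by field_simp
    calc _ ≤ ∫⁻ θ : Fin q → ℝ,
          ENNReal.ofReal (A * (1 / v) * Real.exp (-(a * r ^ 2 / t j / v))) *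
          ENNReal.ofReal (Real.exp (-∑ k, (s k * z (τ k) - (M *ᵥ θ) k) ^ 2)) := by
          refine lintegral_mono fun θ => ?_
          rw [← ENNReal.ofReal_mul (by positivity)]
          exact ENNReal.ofReal_le_ofReal (hpt θ)
      _ = ENNReal.ofReal (A * (1 / v) * Real.exp (-(a * r ^ 2 / t j / v))) *
          (ENNReal.ofReal |M.det⁻¹| * Z) := by
          rw [lintegral_const_mul' _ _ ENNReal.ofReal_ne_top,
            lintegral_exp_neg_sum_sq_comp hM0 fun k => s k * z (τ k)]
      _ = ENNReal.ofReal (A * (∏ k, s k)⁻¹ * (g * (1 / v) *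
          Real.exp (-(a * r ^ 2 / t j / v)))) * Z := by
          rw [← mul_assoc, ← ENNReal.ofReal_mul (by positivity), hMdet, mul_inv, abs_mul,
            abs_of_pos (inv_pos.mpr hsprod)]
          congr 2; ring
      _ ≤ ENNReal.ofReal (C₁ * (t j ^ (-((m : ℝ) / 2)) * v ^ (-((m : ℝ) / 2))) * (g * (1 / v) *
          Real.exp (-(a * r ^ 2 / t j / v)))) * Z := by gcongr
      _ = _ := by
          rw [mul_right_comm (ENNReal.ofReal _) Z, ← ENNReal.ofReal_mul (by positivity),
            Real.rpow_sub_one hv.ne']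
          congr 2; ring
  calc marginalLikelihood H R y
      ≤ ∫⁻ v in Set.Ioi (0 : ℝ), ENNReal.ofReal (C₁ * g * t j ^ (-((m : ℝ) / 2))) * Z *
        ENNReal.ofReal (v ^ (-((m : ℝ) / 2) - 1) * Real.exp (-(a * r ^ 2 / t j / v))) :=
        setLIntegral_mono' measurableSet_Ioi fun v hv => hinner v hv
    _ ≤ ENNReal.ofReal (C₁ * g * t j ^ (-((m : ℝ) / 2))) * Z *
        ENNReal.ofReal (C * (a * r ^ 2 / t j) ^ (-((m : ℝ) / 2))) := by
        rw [lintegral_const_mul' _ _ (ENNReal.mul_ne_top ENNReal.ofReal_ne_top hZt)]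
        gcongr
        exact hCint _ (by positivity)
    -- The factor `t j ^ (-m / 2)` from the determinant cancels the factor `t j ^ (m / 2)` from the
    -- integral over the variance.
    _ = _ := by
        rw [mul_right_comm, ← ENNReal.ofReal_mul (by positivity)]
        congr 2
        rw [Real.div_rpow (by positivity) htjp.le]
        have : t j ^ (-((m : ℝ) / 2)) ≠ 0 := by positivity
        field_simp

theorem normalDensity_eq_zero_of_det_eq_zero {n : ℕ} {R : Matrix (Fin n) (Fin n) ℝ}
    (hR : R.det = 0) (μ : Fin n → ℝ) (v : ℝ) (y : Fin n → ℝ) : normalDensity μ v R y = 0 := by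
  simp [normalDensity, hR]

theorem ae_linearMap_apply_ne_zero {n : ℕ} (f : (Fin n → ℝ) →ₗ[ℝ] ℝ) {y₀ : Fin n → ℝ}
    (h : f y₀ ≠ 0) : ∀ᵐ y : Fin n → ℝ, f y ≠ 0 := by
  have hne : LinearMap.ker f ≠ ⊤ := fun ht => h (by
    have : y₀ ∈ LinearMap.ker f := by rw [ht]; trivial
    exact this)
  have := Measure.addHaar_submodule (volume : Measure (Fin n → ℝ)) (LinearMap.ker f) hne
  rw [ae_iff]
  refine Eq.trans (congrArg _ ?_) this
  ext y; simp

theorem mulVec_eq_zero_of_rank_eq {n q : ℕ} {H : Matrix (Fin n) (Fin q) ℝ} (hH : H.rank = q)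
    {a : Fin q → ℝ} (ha : H *ᵥ a = 0) : a = 0 := by
  have h := LinearMap.finrank_range_add_finrank_ker H.mulVecLin
  have h1 : Module.finrank ℝ (LinearMap.range H.mulVecLin) = q := hH
  rw [h1, Module.finrank_fin_fun, Nat.add_eq_left, Submodule.finrank_eq_zero] at h
  have : a ∈ LinearMap.ker H.mulVecLin := ha
  rw [h] at this
  simpa using this

/-- For almost all data, the marginal likelihood is bounded on the correlation matrices that are
framed by given vectors. -/
theorem ae_exists_marginalLikelihood_le {κ : Type*} [Fintype κ] {n q : ℕ} (hq : q < n)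
    (w : κ → Fin n → ℝ) {K : ℝ} (hK : 0 < K) (H : Matrix (Fin n) (Fin q) ℝ) (hH : H.rank = q) :
    ∀ᵐ y : Fin n → ℝ, ∃ L : NNReal, ∀ R : Matrix (Fin n) (Fin n) ℝ,
      IsFramed w K (fun i j => R i j) → marginalLikelihood H R y ≤ L := by
  classical
  obtain ⟨D, hD, hcomp⟩ := exists_diagonal_comparison w hK
  -- data that determine the finitely many diagonal bounds
  let W : (Fin n → κ) → Matrix (Fin n) (Fin n) ℝ := fun σ => Matrix.of fun i => w (σ i)
  let G : (Fin n → κ) → Matrix (Fin n) (Fin q) ℝ := fun σ => (W σ)⁻¹ᵀ * H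
  let B : (Fin n → κ) → (Fin q → Fin n) → Fin n → Fin q → ℝ :=
    fun σ τ j => G σ j ᵥ* ((G σ).submatrix τ id)⁻¹
  let r : (Fin n → κ) → (Fin q → Fin n) → Fin n → (Fin n → ℝ) → ℝ :=
    fun σ τ j y => (y ᵥ* (W σ)⁻¹) j - ∑ k, B σ τ j k * (y ᵥ* (W σ)⁻¹) (τ k)
  have hae : ∀ σ τ j, (W σ).det ≠ 0 → (∀ k, τ k ≠ j) → ∀ᵐ y : Fin n → ℝ, r σ τ j y ≠ 0 := by
    intro σ τ j hσ hj
    let V : (Fin n → ℝ) →ₗ[ℝ] (Fin n → ℝ) := (W σ)⁻¹.vecMulLinear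
    let f : (Fin n → ℝ) →ₗ[ℝ] ℝ := LinearMap.proj j ∘ₗ V -
      ∑ k, B σ τ j k • (LinearMap.proj (τ k) ∘ₗ V)
    have hf : ∀ y, f y = r σ τ j y := fun y => by
      simp [f, r, V, LinearMap.sum_apply]
    -- At row `j` of `W` the transformed data are the `j`th unit vector, so the residual equals `1`
    -- because no `τ k` is `j`.
    refine (ae_linearMap_apply_ne_zero f (y₀ := Pi.single j 1 ᵥ* W σ) ?_).mono
      fun y hy => by rwa [← hf]
    rw [hf]
    simp only [r, Matrix.vecMul_vecMul, Matrix.mul_nonsing_inv _ (isUnit_iff_ne_zero.mpr hσ),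
      Matrix.vecMul_one]
    rw [Finset.sum_eq_zero fun k _ => by rw [Pi.single_apply, if_neg (hj k), mul_zero]]
    simp
  have hall : ∀ᵐ y : Fin n → ℝ, ∀ σ τ j, (W σ).det ≠ 0 → (∀ k, τ k ≠ j) → r σ τ j y ≠ 0 := by
    simp only [ae_all_iff]
    exact fun σ τ j h1 h2 => hae σ τ j h1 h2
  refine hall.mono fun y hy => ?_
  -- The side conditions come after the constant, so that every index has one, zero if inadmissible.
  -- The sum over this finite index set then serves all `R`.
  have hbound : ∀ ω : (Fin n → κ) × (Fin q → Fin n) × Fin n, ∃ L : NNReal,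
      (W ω.1).det ≠ 0 → Function.Injective ω.2.1 → ((G ω.1).submatrix ω.2.1 id).det ≠ 0 →
      (∀ k, ω.2.1 k ≠ ω.2.2) → ∀ (R : Matrix (Fin n) (Fin n) ℝ) (t : Fin n → ℝ),
      R.IsHermitian → (∀ i, 0 < t i) →
      (∀ a, ∑ i, t i * (W ω.1 *ᵥ a) i ^ 2 ≤ a ⬝ᵥ (R *ᵥ a) ∧
        a ⬝ᵥ (R *ᵥ a) ≤ D * ∑ i, t i * (W ω.1 *ᵥ a) i ^ 2) →
      (∀ k, B ω.1 ω.2.1 ω.2.2 k ≠ 0 → t (ω.2.1 k) ≤ t ω.2.2) →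
      (∀ i, (∀ k, ω.2.1 k ≠ i) → t ω.2.2 ≤ t i) → marginalLikelihood H R y ≤ L := by
    rintro ⟨σ, τ, j⟩
    by_cases h : (W σ).det ≠ 0 ∧ Function.Injective τ ∧ ((G σ).submatrix τ id).det ≠ 0 ∧
      ∀ k, τ k ≠ j
    · obtain ⟨h1, h2, h3, h4⟩ := h
      obtain ⟨L, hL⟩ := exists_marginalLikelihood_le hq h1 hD H h2 h3 h4 (B σ τ j)
        (by rw [Matrix.vecMul_vecMul, Matrix.nonsing_inv_mul _ (isUnit_iff_ne_zero.mpr h3),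
          Matrix.vecMul_one]) y (hy σ τ j h1 h4)
      exact ⟨L, fun _ _ _ _ => hL⟩
    · exact ⟨0, fun h1 h2 h3 h4 => absurd ⟨h1, h2, h3, h4⟩ h⟩
  choose L hL using hbound
  refine ⟨∑ ω, L ω, fun R hR => ?_⟩
  -- For singular `R` the density is zero through `0⁻¹ = 0`, so the bound is trivial.
  by_cases hdet : R.det = 0
  · simp [marginalLikelihood, normalDensity_eq_zero_of_det_eq_zero hdet]
  obtain ⟨σ, hσ, t, ht, hRt⟩ := hcomp R hR hdet
  have hRH : R.IsHermitian := by ext i j; simpa using (hR.1 j i)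
  have hG0 : ∀ a : Fin q → ℝ, (∀ k ∈ Finset.univ, G σ k ⬝ᵥ a = 0) → a = 0 := fun a ha => by
    have h1 : G σ *ᵥ a = 0 := by ext k; exact ha k (Finset.mem_univ k)
    have h2 : (W σ)ᵀ *ᵥ (G σ *ᵥ a) = H *ᵥ a := by
      rw [Matrix.mulVec_mulVec, ← Matrix.mul_assoc, ← Matrix.transpose_mul,
        Matrix.nonsing_inv_mul _ (isUnit_iff_ne_zero.mpr hσ), Matrix.transpose_one,
        Matrix.one_mul]
    rw [h1, Matrix.mulVec_zero] at h2
    exact mulVec_eq_zero_of_rank_eq hH h2.symm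
  -- The negated weights make the greedy choice prefer rows of small weight, the most precise
  -- observations.
  obtain ⟨τ, hτ, -, hτd, hτw⟩ := exists_greedy_basis (fun k => G σ k) (fun i => -t i)
    Finset.univ hG0
  obtain ⟨j, hj, hjmin⟩ := Finset.exists_min_image (Finset.univ.image τ)ᶜ t (by
    rw [← Finset.card_pos, Finset.card_compl, Finset.card_image_of_injective _ hτ]
    simpa using hq)
  have hj' : ∀ k, τ k ≠ j := by simpa using hj
  refine (hL (σ, τ, j) hσ hτ hτd hj' R t hRH ht hRt
    (fun k hk => neg_le_neg_iff.mp (hτw j (Finset.mem_univ j) k hk))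
    (fun i hi => hjmin i (by simpa using hi))).trans ?_
  exact_mod_cast Finset.single_le_sum (f := L) (fun _ _ => zero_le) (Finset.mem_univ (σ, τ, j))

/-- Needed for the supremum of the posterior to be positive. -/
theorem marginalLikelihood_pos {n q : ℕ} (H : Matrix (Fin n) (Fin q) ℝ)
    {R : Matrix (Fin n) (Fin n) ℝ} (hR : 0 < R.det) (y : Fin n → ℝ) :
    0 < marginalLikelihood H R y := by
  have hm : Measurable fun p : ℝ × (Fin q → ℝ) =>
      ENNReal.ofReal (normalDensity (H *ᵥ p.2) p.1 R y * (1 / p.1)) := by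
    have h1 : Continuous fun p : ℝ × (Fin q → ℝ) =>
        (y - H *ᵥ p.2) ⬝ᵥ (R⁻¹ *ᵥ (y - H *ᵥ p.2)) := by fun_prop
    have h2 := h1.measurable
    unfold normalDensity
    fun_prop
  have hpos : ∀ v : ℝ, 0 < v → ∀ θ : Fin q → ℝ,
      0 < ENNReal.ofReal (normalDensity (H *ᵥ θ) v R y * (1 / v)) := fun v hv θ => by
    rw [ENNReal.ofReal_pos]
    unfold normalDensity
    have : 0 < (2 * Real.pi * v) ^ n * R.det := by positivity
    positivity
  unfold marginalLikelihood
  rw [lintegral_pos_iff_support hm.lintegral_prod_right']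
  have hsub : Set.Ioi (0 : ℝ) ⊆ Function.support fun v => ∫⁻ θ : Fin q → ℝ,
      ENNReal.ofReal (normalDensity (H *ᵥ θ) v R y * (1 / v)) := fun v hv => by
    have hmv : Measurable fun θ : Fin q → ℝ =>
        ENNReal.ofReal (normalDensity (H *ᵥ θ) v R y * (1 / v)) := hm.comp measurable_prodMk_left
    change _ ≠ _
    rw [← pos_iff_ne_zero, lintegral_pos_iff_support hmv]
    have : (Function.support fun θ : Fin q → ℝ =>
        ENNReal.ofReal (normalDensity (H *ᵥ θ) v R y * (1 / v))) = Set.univ :=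
      Set.eq_univ_of_forall fun θ => (hpos v hv θ).ne'
    exact (isOpen_univ.measure_pos volume Set.univ_nonempty).trans_le
      (measure_mono this.symm.subset)
  refine lt_of_lt_of_le ?_ (measure_mono hsub)
  simp

/-! ### Range parameters along degenerate limits -/

section Limits

variable {n p : ℕ} {c : Fin p → CorrFamily} {x : Fin n → Fin p → ℝ}

theorem corrMatrix_apply_eq_prod_profile (hc : ∀ l, (c l).Admissible) {γ : Fin p → ℝ}
    (hγ : ∀ l, 0 < γ l) (i j : Fin n) :
    corrMatrix c x γ i j = ∏ l, (c l).profile (|x i l - x j l| * (1 / γ l)) := by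
  simp only [corrMatrix, Matrix.of_apply]
  refine Finset.prod_congr rfl fun l _ => ?_
  rw [CorrFamily.corr_eq_profile (hc l) (hγ l) (abs_nonneg _), div_eq_mul_one_div]

/-- An entry is at most its factor in coordinate `l`. For two points that differ there, this factor
stays below a constant less than `1` as long as the inverse range is at least `ε`. -/
theorem tendsto_inv_range_of_tendsto_ones (hc : ∀ l, (c l).Admissible)
    (hvar : ∀ l, ∃ i j, x i l ≠ x j l) {γ : ℕ → Fin p → ℝ} (hγ : ∀ k l, 0 < γ k l)
    (h : Tendsto (fun k => corrMatrix c x (γ k)) atTop (𝓝 (Matrix.of fun _ _ => (1 : ℝ))))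
    (l : Fin p) : Tendsto (fun k => 1 / γ k l) atTop (𝓝 0) := by
  obtain ⟨i, j, hij⟩ := hvar l
  have hd : 0 < |x i l - x j l| := abs_pos.mpr (sub_ne_zero.mpr hij)
  have hent : Tendsto (fun k => corrMatrix c x (γ k) i j) atTop (𝓝 1) := by
    simpa using tendsto_pi_nhds.mp (tendsto_pi_nhds.mp h i) j
  have hpos : ∀ k l, 0 < 1 / γ k l := fun k l => one_div_pos.mpr (hγ k l)
  refine tendsto_order.mpr ⟨fun a ha => Eventually.of_forall fun k => ha.trans (hpos k l),
    fun ε hε => ?_⟩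
  have hlt := CorrFamily.profile_lt_one (hc l) (mul_pos hd hε)
  filter_upwards [hent.eventually_const_lt hlt] with k hk
  by_contra! hle
  refine absurd hk (not_lt.mpr ?_)
  rw [corrMatrix_apply_eq_prod_profile hc (hγ k)]
  calc _ ≤ (c l).profile (|x i l - x j l| * (1 / γ k l)) := by
        rw [← Finset.mul_prod_erase _ _ (Finset.mem_univ l)]
        refine mul_le_of_le_one_right (CorrFamily.profile_pos (hc l) _).le
          (Finset.prod_le_one (fun l' _ => (CorrFamily.profile_pos (hc l') _).le)
            fun l' _ => CorrFamily.profile_le_one (hc l')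
              (mul_nonneg (abs_nonneg _) (hpos k l').le))
    _ ≤ _ := CorrFamily.profile_antitone (hc l) (by positivity) (by gcongr)

/-- If all inverse ranges are at most `B`, an off-diagonal entry stays above a positive constant.
The large coordinate may vary along the sequence. -/
theorem eventually_exists_lt_inv_range_of_tendsto_one (hc : ∀ l, (c l).Admissible)
    {i j : Fin n} (hij : i ≠ j) {γ : ℕ → Fin p → ℝ} (hγ : ∀ k l, 0 < γ k l)
    (h : Tendsto (fun k => corrMatrix c x (γ k)) atTop (𝓝 1)) (B : ℝ) :
    ∀ᶠ k in atTop, ∃ l, B < 1 / γ k l := by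
  have hent : Tendsto (fun k => corrMatrix c x (γ k) i j) atTop (𝓝 0) := by
    have := tendsto_pi_nhds.mp (tendsto_pi_nhds.mp h i) j
    rwa [Matrix.one_apply_ne hij] at this
  have hpos : 0 < ∏ l, (c l).profile (|x i l - x j l| * B) :=
    Finset.prod_pos fun l _ => CorrFamily.profile_pos (hc l) _
  filter_upwards [hent.eventually_lt_const hpos] with k hk
  by_contra! hle
  refine absurd hk (not_lt.mpr ?_)
  rw [corrMatrix_apply_eq_prod_profile hc (hγ k)]
  refine Finset.prod_le_prod (fun l _ => (CorrFamily.profile_pos (hc l) _).le) fun l _ => ?_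
  refine CorrFamily.profile_antitone (hc l)
    (mul_nonneg (abs_nonneg _) (one_div_pos.mpr (hγ k l)).le) ?_
  exact mul_le_mul_of_nonneg_left (hle l) (abs_nonneg _)

/-- As all ranges shrink together the matrix tends to the identity, since distinct points differ in
some coordinate; so the determinant tends to `1`. -/
theorem exists_corrMatrix_det_pos (hc : ∀ l, (c l).Admissible) (hx : Function.Injective x) :
    ∃ γ : Fin p → ℝ, (∀ l, 0 < γ l) ∧ 0 < (corrMatrix c x γ).det := by
  have hγ : ∀ k : ℕ, ∀ _l : Fin p, (0 : ℝ) < 1 / (k + 1) := fun k _ => by positivity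
  have hlim : Tendsto (fun k : ℕ => corrMatrix c x fun _ => 1 / ((k : ℝ) + 1)) atTop (𝓝 1) := by
    refine tendsto_pi_nhds.mpr fun i => tendsto_pi_nhds.mpr fun j => ?_
    simp only [corrMatrix_apply_eq_prod_profile hc (hγ _)]
    have hl : ∀ l, Tendsto (fun k : ℕ => (c l).profile
        (|x i l - x j l| * (1 / (1 / ((k : ℝ) + 1))))) atTop
        (𝓝 (if x i l = x j l then 1 else 0)) := fun l => by
      split_ifs with h
      · simp [h, CorrFamily.profile_zero (hc l)]
      · refine (CorrFamily.tendsto_profile_atTop (hc l)).comp ?_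
        simp only [one_div_one_div]
        exact (tendsto_atTop_add_const_right _ _ tendsto_natCast_atTop_atTop).const_mul_atTop
          (abs_pos.mpr (sub_ne_zero.mpr h))
    have := tendsto_finsetProd Finset.univ fun l _ => hl l
    convert this using 2
    rw [Matrix.one_apply]
    by_cases h : i = j
    · simp [h]
    · have : ∃ l, x i l ≠ x j l := by
        by_contra! hall
        exact h (hx (funext hall))
      obtain ⟨l, hl⟩ := this
      rw [if_neg h]
      exact (Finset.prod_eq_zero (Finset.mem_univ l) (if_neg hl)).symm
  have hdet : Tendsto (fun k : ℕ => (corrMatrix c x fun _ => 1 / ((k : ℝ) + 1)).det) atTop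
      (𝓝 1) := by
    have hc : Continuous fun A : Matrix (Fin n) (Fin n) ℝ => A.det := by fun_prop
    have := (hc.tendsto 1).comp hlim
    rwa [Matrix.det_one] at this
  obtain ⟨k, hk⟩ := (hdet.eventually_const_lt zero_lt_one).exists
  exact ⟨_, hγ k, hk⟩

theorem tendsto_rpow_mul_exp_neg_nhds_zero {s b : ℝ} (hs : 0 < s) :
    Tendsto (fun S : ℝ => S ^ s * Real.exp (-b * S)) (𝓝 0) (𝓝 0) := by
  have h1 : ContinuousAt (fun S : ℝ => S ^ s * Real.exp (-b * S)) 0 :=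
    (Real.continuousAt_rpow_const _ _ (Or.inr hs.le)).mul (by fun_prop)
  have := h1.tendsto
  simpa [Real.zero_rpow hs.ne'] using this

end Limits

/-! ### Robustness from the two bounds -/

/-- Robustness for a bounded likelihood and a prior that is dominated by
`S ^ s * exp (-b * S)`, where `S` is the weighted sum of the inverse range parameters. -/
theorem isRobustEstimation_of_bounds {n p : ℕ} {c : Fin p → CorrFamily}
    (hp : 0 < p) (hc : ∀ l, (c l).Admissible) {x : Fin n → Fin p → ℝ}
    (hvar : ∀ l, ∃ i j, x i l ≠ x j l) {Θ : Type*} {P : Set Θ} {γ : Θ → Fin p → ℝ}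
    (hγ : ∀ θ ∈ P, ∀ l, 0 < γ θ l) {L : Θ → ℝ≥0∞} {B : NNReal} (hL : ∀ θ ∈ P, L θ ≤ B)
    {π : Θ → ℝ} {C : Fin p → ℝ} (hC : ∀ l, 0 < C l) {s b k₀ : ℝ} (hs : 0 < s) (hb : 0 < b)
    (hπ : ∀ θ ∈ P, π θ ≤ k₀ * ((∑ l, C l * (1 / γ θ l)) ^ s *
      Real.exp (-b * ∑ l, C l * (1 / γ θ l))))
    (hpos : ∃ θ ∈ P, 0 < L θ ∧ 0 < π θ) :
    IsRobustEstimation P (fun θ => L θ * ENNReal.ofReal (π θ)) (fun θ => corrMatrix c x (γ θ)) := by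
  -- along a degenerate sequence the objective tends to zero
  have key : ∀ u : ℕ → Θ, (∀ k, u k ∈ P) →
      Tendsto (fun k => L (u k) * ENNReal.ofReal (π (u k))) atTop
        (𝓝 (⨆ θ ∈ P, L θ * ENNReal.ofReal (π θ))) →
      ∀ F : Filter ℝ, Tendsto (fun k => ∑ l, C l * (1 / γ (u k) l)) atTop F →
      Tendsto (fun S : ℝ => S ^ s * Real.exp (-b * S)) F (𝓝 0) → False := by
    intro u hu hsup F hF hlim
    have h1 := ((hlim.comp hF).const_mul k₀)
    rw [mul_zero] at h1
    have h2 := ENNReal.Tendsto.const_mul (a := (B : ℝ≥0∞)) (ENNReal.tendsto_ofReal h1)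
      (Or.inr ENNReal.coe_ne_top)
    rw [ENNReal.ofReal_zero, mul_zero] at h2
    have h3 : Tendsto (fun k => L (u k) * ENNReal.ofReal (π (u k))) atTop (𝓝 0) :=
      tendsto_of_tendsto_of_tendsto_of_le_of_le tendsto_const_nhds h2 (fun _ => zero_le)
        fun k => mul_le_mul' (hL _ (hu k)) (ENNReal.ofReal_le_ofReal (hπ _ (hu k)))
    have h4 := tendsto_nhds_unique hsup h3
    obtain ⟨θ, hθ, hLθ, hπθ⟩ := hpos
    have h5 : 0 < L θ * ENNReal.ofReal (π θ) :=
      ENNReal.mul_pos hLθ.ne' (ENNReal.ofReal_pos.mpr hπθ).ne'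
    have h6 := h5.trans_le (le_iSup₂ (f := fun θ (_ : θ ∈ P) => L θ * ENNReal.ofReal (π θ)) θ hθ)
    exact h6.ne' h4
  rintro M ⟨u, hu, hsup, hR⟩
  constructor
  · rintro rfl
    have h := tendsto_inv_range_of_tendsto_ones hc hvar (fun k => hγ _ (hu k)) hR
    refine key u hu hsup (𝓝 0) ?_ (tendsto_rpow_mul_exp_neg_nhds_zero hs)
    simpa using tendsto_finsetSum Finset.univ fun l _ => (h l).const_mul (C l)
  · rintro rfl
    refine key u hu hsup atTop ?_ (tendsto_rpow_mul_exp_neg_mul_atTop_nhds_zero s b hb)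
    obtain ⟨i, j, hij⟩ := hvar ⟨0, hp⟩
    have hij' : i ≠ j := fun h => hij (by rw [h])
    refine tendsto_atTop.mpr fun b' => ?_
    -- Whichever coordinate exceeds `T`, its term alone must lift the weighted sum above `b'`; the
    -- sum over `l` is a threshold valid for all coordinates.
    set T := ∑ l, |b'| / C l with hT
    filter_upwards [eventually_exists_lt_inv_range_of_tendsto_one hc hij'
      (fun k => hγ _ (hu k)) hR T] with k hk
    obtain ⟨l, hl⟩ := hk
    have hβ : ∀ l, 0 < 1 / γ (u k) l := fun l => one_div_pos.mpr (hγ _ (hu k) l)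
    have h1 : |b'| / C l ≤ T := Finset.single_le_sum (f := fun l => |b'| / C l)
      (fun l _ => div_nonneg (abs_nonneg _) (hC l).le) (Finset.mem_univ l)
    have h2 : C l * (1 / γ (u k) l) ≤ ∑ l, C l * (1 / γ (u k) l) :=
      Finset.single_le_sum (f := fun l => C l * (1 / γ (u k) l))
        (fun l _ => mul_nonneg (hC l).le (hβ l).le) (Finset.mem_univ l)
    have h3 : |b'| / C l < 1 / γ (u k) l := h1.trans_lt hl
    rw [div_lt_iff₀ (hC l)] at h3
    linarith [le_abs_self b']

/-! ### Decay of the jointly robust prior -/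

section Prior

variable {p : ℕ} {a b : ℝ} {C β : Fin p → ℝ}

theorem weightedSum_pos (hp : 0 < p) (hC : ∀ l, 0 < C l) (hβ : ∀ l, 0 < β l) :
    0 < ∑ l, C l * β l :=
  Finset.sum_pos (fun l _ => mul_pos (hC l) (hβ l)) ⟨⟨0, hp⟩, Finset.mem_univ _⟩

theorem jrPrior_pos (hp : 0 < p) (ha : -(p : ℝ) < a) (hb : 0 < b) (hC : ∀ l, 0 < C l)
    (hβ : ∀ l, 0 < β l) : 0 < jrPrior a b C β := by
  have hS := weightedSum_pos hp hC hβ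
  have hΓ := Real.Gamma_pos_of_pos (by linarith : 0 < a + p)
  have hCp : 0 < ∏ l, C l := Finset.prod_pos fun l _ => hC l
  unfold jrPrior
  positivity

/-- Each `β l` is at most `S / C l`, so a Jacobian `∏ l, β l ^ e` contributes degree `p * e` in `S`.
The values `e = 2, 1, 0` belong to `γ`, `ξ` and `β`; positivity of `a + p * e` is the source of the
two conditions on `a`, together with `a > -p` for the sign of the normalizing constant. -/
theorem exists_jrPrior_mul_prod_pow_le (hp : 0 < p) (ha : -(p : ℝ) < a) (hb : 0 < b)
    (hC : ∀ l, 0 < C l) (e : ℕ) :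
    ∃ k₀ : ℝ, ∀ β : Fin p → ℝ, (∀ l, 0 < β l) → jrPrior a b C β * ∏ l, β l ^ e ≤
      k₀ * ((∑ l, C l * β l) ^ (a + p * e) * Real.exp (-b * ∑ l, C l * β l)) := by
  refine ⟨(((p - 1).factorial : ℝ) * b ^ (a + p) * ∏ l, C l) / Real.Gamma (a + p) *
    ∏ l, (C l)⁻¹ ^ e, fun β hβ => ?_⟩
  have hS := weightedSum_pos hp hC hβ
  have hΓ := Real.Gamma_pos_of_pos (by linarith : 0 < a + p)
  have hCp : 0 < ∏ l, C l := Finset.prod_pos fun l _ => hC l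
  have h1 : ∏ l, β l ^ e ≤ ∏ l, ((C l)⁻¹ * ∑ l, C l * β l) ^ e := by
    refine Finset.prod_le_prod (fun l _ => pow_nonneg (hβ l).le _) fun l _ => ?_
    refine pow_le_pow_left₀ (hβ l).le ?_ e
    rw [← div_eq_inv_mul, le_div_iff₀ (hC l), mul_comm]
    exact Finset.single_le_sum (f := fun l => C l * β l)
      (fun l _ => mul_nonneg (hC l).le (hβ l).le) (Finset.mem_univ l)
  set S := ∑ l, C l * β l with hSdef
  have h2 : S ^ (a + p * e) = S ^ a * (S ^ e) ^ p := by
    rw [Real.rpow_add hS, ← pow_mul, ← Real.rpow_natCast S (e * p)]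
    push_cast; rw [mul_comm (p : ℝ)]
  have h3 : ∏ l, ((C l)⁻¹ * S) ^ e = (∏ l, (C l)⁻¹ ^ e) * (S ^ e) ^ p := by
    simp [mul_pow, Finset.prod_mul_distrib]
  rw [h3] at h1
  have h4 : 0 ≤ jrPrior a b C β := (jrPrior_pos hp ha hb hC hβ).le
  refine (mul_le_mul_of_nonneg_left h1 h4).trans (le_of_eq ?_)
  rw [h2, jrPrior]
  ring

end Prior

/-! ### The three parameterizations -/

theorem mainTheorem2 {n p q : ℕ} (hp : 0 < p) (hq : q < n)
    (c : Fin p → CorrFamily) (hc : ∀ l, (c l).Admissible)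
    (x : Fin n → Fin p → ℝ) (hx : Function.Injective x)
    (hvar : ∀ l, ∃ i j, x i l ≠ x j l)
    (h : Fin q → (Fin p → ℝ) → ℝ) (hH : (basisMatrix h x).rank = q) :
    ∀ᵐ y : Fin n → ℝ, ∀ (a b : ℝ) (C : Fin p → ℝ), 0 < b → (∀ l, 0 < C l) →
      (-(p : ℝ) < a → RobustRange c x h a b C y ∧ RobustLogInvRange c x h a b C y) ∧
      (0 < a → RobustInvRange c x h a b C y) := by
  obtain ⟨m, rfl⟩ : ∃ m, n = m + 1 := Nat.exists_eq_succ_of_ne_zero (by omega)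
  obtain ⟨κ, _, w, K, hK, hframe⟩ := exists_isFramed_corrMatrix c hc x
  have hp' : (0 : ℝ) < p := by exact_mod_cast hp
  -- The null set is fixed here, before `a`, `b` and `C` are introduced.
  refine (ae_exists_marginalLikelihood_le hq w hK (basisMatrix h x) hH).mono
    fun y ⟨L, hL⟩ a b C hb hC => ?_
  have hbound : ∀ γ : Fin p → ℝ, (∀ l, 0 < γ l) →
      marginalLikelihood (basisMatrix h x) (corrMatrix c x γ) y ≤ L :=
    fun γ hγ => hL _ (hframe γ hγ)
  obtain ⟨γ₀, hγ₀, hdet⟩ := exists_corrMatrix_det_pos hc hx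
  have hlik := marginalLikelihood_pos (basisMatrix h x) hdet y
  have hβ₀ : ∀ l, 0 < 1 / γ₀ l := fun l => one_div_pos.mpr (hγ₀ l)
  have hlog : (fun l => Real.exp (-Real.log (1 / γ₀ l))) = γ₀ := by
    ext l; rw [one_div, Real.log_inv, neg_neg, Real.exp_log (hγ₀ l)]
  refine ⟨fun ha => ⟨?_, ?_⟩, fun ha => ?_⟩
  · obtain ⟨k₀, hk₀⟩ := exists_jrPrior_mul_prod_pow_le hp ha hb hC 2
    have hs : 0 < a + p * (2 : ℕ) := by push_cast; linarith
    have hpos : 0 < jrPriorRange a b C γ₀ := mul_pos (jrPrior_pos hp ha hb hC hβ₀)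
      (Finset.prod_pos fun l _ => one_div_pos.mpr (pow_pos (hγ₀ l) 2))
    unfold RobustRange
    refine isRobustEstimation_of_bounds hp hc hvar (γ := fun γ => γ) (fun γ hγ => hγ)
      (fun γ hγ => hbound γ hγ) hC hs hb (k₀ := k₀) (fun γ hγ => ?_) ⟨γ₀, hγ₀, hlik, hpos⟩
    simpa [jrPriorRange] using hk₀ (fun l => 1 / γ l) fun l => one_div_pos.mpr (hγ l)
  · obtain ⟨k₀, hk₀⟩ := exists_jrPrior_mul_prod_pow_le hp ha hb hC 1
    have hs : 0 < a + p * (1 : ℕ) := by push_cast; linarith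
    have hpos : 0 < jrPriorLogInvRange a b C fun l => Real.log (1 / γ₀ l) :=
      mul_pos (jrPrior_pos hp ha hb hC fun l => Real.exp_pos _)
        (Finset.prod_pos fun l _ => Real.exp_pos _)
    rw [← hlog] at hlik
    have hξ : ∀ ξ ∈ (Set.univ : Set (Fin p → ℝ)), ∀ l, 0 < Real.exp (-ξ l) :=
      fun ξ _ l => Real.exp_pos _
    have hπ : ∀ ξ ∈ (Set.univ : Set (Fin p → ℝ)), jrPriorLogInvRange a b C ξ ≤
        k₀ * ((∑ l, C l * (1 / Real.exp (-ξ l))) ^ (a + p * (1 : ℕ)) *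
          Real.exp (-b * ∑ l, C l * (1 / Real.exp (-ξ l)))) := fun ξ _ => by
      simpa [jrPriorLogInvRange, Real.exp_neg] using
        hk₀ (fun l => Real.exp (ξ l)) fun l => Real.exp_pos _
    unfold RobustLogInvRange
    exact isRobustEstimation_of_bounds hp hc hvar (P := Set.univ)
      (γ := fun (ξ : Fin p → ℝ) l => Real.exp (-ξ l)) hξ
      (L := fun ξ => marginalLikelihood (basisMatrix h x) (corrMatrix c x fun l => Real.exp (-ξ l)) y)
      (B := L) (fun ξ hmem => hbound _ (hξ ξ hmem)) (π := jrPriorLogInvRange a b C) hC hs hb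
      (k₀ := k₀) hπ ⟨fun l => Real.log (1 / γ₀ l), Set.mem_univ _, hlik, hpos⟩
  · have ha' : -(p : ℝ) < a := by linarith
    obtain ⟨k₀, hk₀⟩ := exists_jrPrior_mul_prod_pow_le hp ha' hb hC 0
    have hs : 0 < a + p * (0 : ℕ) := by simpa using ha
    have hinv : (fun l => 1 / (1 / γ₀ l)) = γ₀ := by ext l; rw [one_div_one_div]
    rw [← hinv] at hlik
    have hβ : ∀ β ∈ {β : Fin p → ℝ | ∀ l, 0 < β l}, ∀ l, 0 < 1 / β l :=
      fun β hβ l => one_div_pos.mpr (hβ l)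
    have hπ : ∀ β ∈ {β : Fin p → ℝ | ∀ l, 0 < β l}, jrPrior a b C β ≤
        k₀ * ((∑ l, C l * (1 / (1 / β l))) ^ (a + p * (0 : ℕ)) *
          Real.exp (-b * ∑ l, C l * (1 / (1 / β l)))) := fun β hβ => by
      simpa using hk₀ β hβ
    unfold RobustInvRange
    exact isRobustEstimation_of_bounds hp hc hvar (P := {β | ∀ l, 0 < β l})
      (γ := fun (β : Fin p → ℝ) l => 1 / β l) hβ
      (L := fun β => marginalLikelihood (basisMatrix h x) (corrMatrix c x fun l => 1 / β l) y)
      (B := L) (fun β hmem => hbound _ (hβ β hmem)) (π := jrPrior a b C) hC hs hb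
      (k₀ := k₀) hπ ⟨fun l => 1 / γ₀ l, hβ₀, hlik, jrPrior_pos hp ha' hb hC hβ₀⟩
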